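/- **Setting.** A complex domain is an open connected subset of $\mathbb C^n$. Let $\omega_0=\frac i2\sum_j dz_j\wedge d\bar z_j$ be the flat form. Let $M\subset\mathbb C^n$ be a complex domain containing the origin and let $\Phi:M\to\mathbb R$ be a radial Kähler potential, i.e. a real-analytic, strictly plurisubharmonic function of the form $\Phi(z)=f(|z|^2)$, where $f$ is real-analytic on $\hat M=\{|z|^2: z\in M\}$ (at every point of $\hat M$, hence on a two-sided neighbourhood of $0$ in $\mathbb R$). Put $\omega=\frac i2\partial\bar\partial\Phi$, and assume that $\omega$ is not proportional to $\omega_0$: there are no non-empty open set $W\subset M$ and $c\in\mathbb R$ with $\omega=c\,\omega_0$ on $W$. Let $(M^*,\Phi^*)$ be a local dual of $(M,\Phi)$: $M^*\subset\mathbb C^n$ is a complex domain containing the origin and $\Phi^*:M^*\to\mathbb R$ is a real-analytic strictly plurisubharmonic function such that, if $\Phi(z)=\sum c_{\alpha\beta}z^\alpha\bar z^\beta$ is the power series of $\Phi$ near $0$, then $\Phi^*(z)=-\sum c_{\alpha\beta}z^\alpha(-\bar z)^\beta$ near $0$. Put $\omega^*=\frac i2\partial\bar\partial\Phi^*$. For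 $\lambda>0$, a $\lambda$-symplectic duality between $\omega$ and $\omega^*$ is a smooth diffeomorphism $\Psi:U\to U^*$ between open neighbourhoods of the origin $U\subset M$, $U^*\subset M^*$ with $$\Psi^*\omega_0=\lambda\,\omega,\qquad \Psi^*(\lambda\,\omega^*)=\omega_0$$ on $U$ (it is not assumed that $\Psi(0)=0$). **Theorem.** Let $\lambda>0$. 1. For every $\lambda$-symplectic duality $\Psi:U\to U^*$ between $\omega$ and $\omega^*$ there exist an open set $V\subset U$ containing the origin, a radial function $g:V\to\mathbb R$ (one that depends only on $|z|^2$) and a unitary matrix $A\in U(n)$ such that $$\Psi(z)=e^{ig(z)}\,\psi(z)\,Az,\qquad z\in V,$$ where $\psi(z)=\bigl(\lambda f'(|z|^2)\bigr)^{1/2}$, with $\lambda f'(|z|^2)>0$ on $V$ and $\psi$ real-analytic on $V$. 2. There exists a $\lambda$-symplectic duality between $\omega$ and $\omega^*$ if and only if $$\lambda^2 f'(x)\,f'\bigl(-\lambda x f'(x)\bigr)=1$$ for all $x$ in an open neighbourhood of the origin of $\mathbb R$. -/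

import Mathlib

open Complex Set Filter Topology
open scoped ContDiff ComplexConjugate

/-- Complex Euclidean space `ℂⁿ`. -/
abbrev Cn (n : ℕ) : Type := EuclideanSpace ℂ (Fin n)

/-- The Wirtinger derivative `∂g/∂z_j = (∂g/∂x_j - i ∂g/∂y_j) / 2`. -/
noncomputable def wirtinger {n : ℕ} (j : Fin n) (g : Cn n → ℂ) (z : Cn n) : ℂ :=
  (1 / 2 : ℂ) * (fderiv ℝ g z (EuclideanSpace.single j (1 : ℂ))
    - I * fderiv ℝ g z (EuclideanSpace.single j I))

/-- The Wirtinger derivative `∂g/∂z̄_j = (∂g/∂x_j + i ∂g/∂y_j) / 2`. -/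
noncomputable def wirtingerBar {n : ℕ} (j : Fin n) (g : Cn n → ℂ) (z : Cn n) : ℂ :=
  (1 / 2 : ℂ) * (fderiv ℝ g z (EuclideanSpace.single j (1 : ℂ))
    + I * fderiv ℝ g z (EuclideanSpace.single j I))

/-- The complex Hessian `∂²Φ / ∂z_j ∂z̄_k` of a real function. -/
noncomputable def complexHessian {n : ℕ} (Φ : Cn n → ℝ) (z : Cn n) (j k : Fin n) : ℂ :=
  wirtinger j (wirtingerBar k (fun w => (Φ w : ℂ))) z

/-- The two-form `(i/2) ∂∂̄Φ = (i/2) ∑ Φ_{j k̄} dz_j ∧ dz̄_k` at `z`, evaluated on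
two real tangent vectors. -/
noncomputable def kahlerForm {n : ℕ} (Φ : Cn n → ℝ) (z v w : Cn n) : ℂ :=
  (I / 2) * ∑ j, ∑ k, complexHessian Φ z j k * (v j * conj (w k) - w j * conj (v k))

/-- The flat form `ω₀ = (i/2) ∑ dz_j ∧ dz̄_j`, evaluated on two tangent vectors
(it does not depend on the base point). -/
noncomputable def flatForm {n : ℕ} (v w : Cn n) : ℂ :=
  (I / 2) * ∑ j, (v j * conj (w j) - w j * conj (v j))

/-- A complex domain: an open connected subset of `ℂⁿ`, here containing the origin. -/
def IsComplexDomain {n : ℕ} (M : Set (Cn n)) : Prop :=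
  IsOpen M ∧ IsConnected M ∧ (0 : Cn n) ∈ M

/-- A Kähler potential on `M`: a real analytic strictly plurisubharmonic function. -/
def IsKahlerPotential {n : ℕ} (M : Set (Cn n)) (Φ : Cn n → ℝ) : Prop :=
  AnalyticOnNhd ℝ Φ M ∧
    ∀ z ∈ M, ∀ v : Cn n, v ≠ 0 →
      0 < (∑ j, ∑ k, complexHessian Φ z j k * (v j * conj (v k))).re

/-- `f` is a real analytic function with `Φ(z) = f(|z|²)` on `M`; analyticity is at every
point of `{|z|² : z ∈ M}`, in particular on a two-sided neighbourhood of `0` in `ℝ`. -/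
def IsAssociatedFunction {n : ℕ} (M : Set (Cn n)) (Φ : Cn n → ℝ) (f : ℝ → ℝ) : Prop :=
  AnalyticOnNhd ℝ f ((fun z : Cn n => ‖z‖ ^ 2) '' M) ∧ ∀ z ∈ M, Φ z = f (‖z‖ ^ 2)

/-- The term `z^α u^β` of a power series in the two groups of variables `z`, `u`;
`p = (α, β)` is a pair of multi-indices. -/
noncomputable def biMonomial {n : ℕ} (p : (Fin n → ℕ) × (Fin n → ℕ)) (z u : Fin n → ℂ) : ℂ :=
  (∏ j, z j ^ p.1 j) * ∏ j, u j ^ p.2 j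

/-- `(Mstar, Φstar)` is a local dual of `Φ`: `Φstar` is a (real valued) Kähler potential on the
domain `Mstar`, and `Φstar(z, z̄) = -Φ(z, -z̄)`: if `Φ = ∑ c_{αβ} z^α z̄^β` is the expansion
of `Φ` around the origin, then `-Φstar = ∑ c_{αβ} z^α (-z̄)^β` around the origin. -/
def IsLocalDual {n : ℕ} (Φ : Cn n → ℝ) (Mstar : Set (Cn n)) (Φstar : Cn n → ℝ) : Prop :=
  IsComplexDomain Mstar ∧ IsKahlerPotential Mstar Φstar ∧
    ∃ c : (Fin n → ℕ) × (Fin n → ℕ) → ℂ,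
      (∀ᶠ z : Cn n in 𝓝 0,
        HasSum (fun p => c p * biMonomial p z (fun j => conj (z j))) (Φ z : ℂ)) ∧
      (∀ᶠ z : Cn n in 𝓝 0,
        HasSum (fun p => c p * biMonomial p z (fun j => -conj (z j))) ((-Φstar z : ℝ) : ℂ))

/-- On no nonempty open subset of `M` is `(i/2) ∂∂̄Φ` a real multiple of the flat form. -/
def NowhereProportional {n : ℕ} (M : Set (Cn n)) (Φ : Cn n → ℝ) : Prop :=
  ¬ ∃ W ⊆ M, IsOpen W ∧ W.Nonempty ∧ ∃ c : ℝ,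
    ∀ z ∈ W, ∀ v w : Cn n, kahlerForm Φ z v w = c * flatForm v w

/-- `Ψ` restricts to a smooth diffeomorphism from the open set `U` onto the open set `V`. -/
def IsDiffeoOn {n : ℕ} (U V : Set (Cn n)) (Ψ : Cn n → Cn n) : Prop :=
  IsOpen U ∧ IsOpen V ∧ MapsTo Ψ U V ∧ ContDiffOn ℝ ∞ Ψ U ∧
    ∃ Θ : Cn n → Cn n, MapsTo Θ V U ∧ ContDiffOn ℝ ∞ Θ V ∧ InvOn Θ Ψ U V

/-- `Ψ : U → Ustar` is a (local) `lam`-symplectic duality between `ω = (i/2) ∂∂̄Φ` on `M` and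
`ωstar = (i/2) ∂∂̄Φstar` on `Mstar`: a diffeomorphism between open neighbourhoods of the origin
with `Ψ^* ω₀ = lam ω` and `Ψ^* (lam ωstar) = ω₀` on `U`. -/
structure IsSymplecticDuality {n : ℕ} (lam : ℝ) (M : Set (Cn n)) (Φ : Cn n → ℝ)
    (Mstar : Set (Cn n)) (Φstar : Cn n → ℝ) (U Ustar : Set (Cn n)) (Ψ : Cn n → Cn n) : Prop where
  subset_left : U ⊆ M
  subset_right : Ustar ⊆ Mstar
  zero_mem_left : (0 : Cn n) ∈ U
  zero_mem_right : (0 : Cn n) ∈ Ustar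
  diffeo : IsDiffeoOn U Ustar Ψ
  pullback_flat : ∀ z ∈ U, ∀ v w : Cn n,
    flatForm (fderiv ℝ Ψ z v) (fderiv ℝ Ψ z w) = lam * kahlerForm Φ z v w
  pullback_dual : ∀ z ∈ U, ∀ v w : Cn n,
    lam * kahlerForm Φstar (Ψ z) (fderiv ℝ Ψ z v) (fderiv ℝ Ψ z w) = flatForm v w

/-- `g` depends only on `|z|²` on `V`. -/
def IsRadialOn {n : ℕ} (V : Set (Cn n)) (g : Cn n → ℝ) : Prop :=
  ∀ z ∈ V, ∀ w ∈ V, ‖z‖ ^ 2 = ‖w‖ ^ 2 → g z = g w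

/-!
Write `h(x) = x f'(x)`. On the complex line through `z` the form `ω` is `h'(|z|²) ω₀`, on its
orthogonal complement it is `f'(|z|²) ω₀`; near the origin the dual potential is `-f(-|z|²)`, so
`ω*` has the corresponding eigenvalues at `-|z|²`. A duality `Ψ` conjugates the endomorphism of
`λ ω` (relative to `ω₀`) to the inverse of that of `λ ω*`.

*Spheres go to spheres.* Comparing traces, `tr(λ ω*)` at `Ψ(z)` is an analytic function `S(|z|²)`.
The trace of `ω*` is real-analytic on `M*` and radial near the origin, so by analytic continuation it
is infinitesimally rotation invariant everywhere, and it is not constant because `ω` is not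
proportional to `ω₀`. Since the level set of `S(|z|²)` through the origin is isolated, `Ψ(0) = 0`
(`map_zero_of_radial_invariant`), and then `|Ψ(z)|` depends only on `|z|`.

*Equivariance.* The field `i z` is Hamiltonian, for `ω₀` with Hamiltonian a multiple of `|z|²` and for
`ω` with a multiple of `h(|z|²)`. Hence `Ψ` carries a radial multiple of `i z` to the field `i w`; as both
flows are periodic and `Ψ` is injective and close to its conformal linear part, the multiple is one
(`IsRadialDuality.exists_fderiv_I_smul`). So `|Ψ(z)|² = λ h(|z|²)`, and the eigenvalue identity along
`i z` is `λ² h'(x) h'(-λ h(x)) = 1`, which integrates to the functional equation.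

*Normal form.* The radial field is an eigenvector too, since `f''` vanishes at most at the origin. So
the complex line through `Ψ(r z)` does not depend on `r`, and letting `r → 0` gives `Ψ = σ A` with `A`
unitary and `σ` complex valued (`IsRadialDuality.exists_apply_eq_smul`). Preservation of symplectic
orthogonality forces the derivative of `σ` to vanish along spheres, so `σ` is radial, and its modulus
is `(λ f')^{1/2}`.

Conversely `z ↦ (λ f'(|z|²))^{1/2} z` pulls `ω₀` back to `λ ω` for every potential `f`; the functional
equation says that its inverse is the same construction for the dual potential.
-/

/-! ### The Kähler form of a radial potential -/

theorem real_inner_eq_re {n : ℕ} (v w : Cn n) : inner ℝ v w = (inner ℂ v w).re := by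
  simp [PiLp.inner_apply, Complex.inner]

theorem inner_eq_sum_conj_mul {n : ℕ} (v w : Cn n) : inner ℂ v w = ∑ j, conj (v j) * w j := by
  simp [PiLp.inner_apply, mul_comm]

theorem flatForm_eq_im_inner {n : ℕ} (v w : Cn n) : flatForm v w = ((inner ℂ v w).im : ℂ) := by
  have h : flatForm v w = (I / 2) * (inner ℂ w v - inner ℂ v w) := by
    simp only [flatForm, inner_eq_sum_conj_mul, ← Finset.sum_sub_distrib]
    congr 1
    exact Finset.sum_congr rfl fun j _ => by ring
  rw [h, ← inner_conj_symm w v]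
  generalize inner ℂ v w = c
  apply Complex.ext <;> simp
  ring

/-- The value on `v, w`, at the point `z`, of the two-form
`a ω₀ + b (i/2) ∂|z|² ∧ ∂̄|z|²`. -/
noncomputable def radialForm {n : ℕ} (a b : ℝ) (z v w : Cn n) : ℝ :=
  a * (inner ℂ v w).im + b * (conj (inner ℂ z v) * inner ℂ z w).im

theorem radialForm_eq_im_inner {n : ℕ} (a b : ℝ) (z v w : Cn n) :
    radialForm a b z v w
      = (inner ℂ ((a : ℂ) • v + ((b : ℂ) * inner ℂ z v) • z) w).im := by
  simp only [radialForm, inner_add_left, inner_smul_left, map_mul, conj_ofReal]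
  simp [mul_im, mul_re]
  ring

theorem hasFDerivAt_comp_norm_sq {n : ℕ} {φ : ℝ → ℝ} {z : Cn n}
    (hφ : DifferentiableAt ℝ φ (‖z‖ ^ 2)) :
    HasFDerivAt (fun w : Cn n => φ (‖w‖ ^ 2))
      (deriv φ (‖z‖ ^ 2) • ((2 : ℝ) • innerSL ℝ z)) z := by
  have h := (hasStrictFDerivAt_norm_sq z).hasFDerivAt
  exact (hφ.hasDerivAt.comp_hasFDerivAt z h).congr_fderiv (by ext; simp)

theorem eventually_analyticAt_norm_sq {n : ℕ} {φ : ℝ → ℝ} {z : Cn n}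
    (hφ : AnalyticAt ℝ φ (‖z‖ ^ 2)) : ∀ᶠ w : Cn n in 𝓝 z, AnalyticAt ℝ φ (‖w‖ ^ 2) :=
  ((by fun_prop : Continuous fun w : Cn n => ‖w‖ ^ 2).tendsto z).eventually
    hφ.eventually_analyticAt

theorem inner_single_one {n : ℕ} (z : Cn n) (j : Fin n) :
    inner ℂ z (EuclideanSpace.single j (1 : ℂ)) = conj (z j) := by
  simp [EuclideanSpace.inner_single_right]

theorem inner_single_I {n : ℕ} (z : Cn n) (j : Fin n) :
    inner ℂ z (EuclideanSpace.single j I) = I * conj (z j) := by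
  simp [EuclideanSpace.inner_single_right]

theorem wirtingerBar_comp_norm_sq {n : ℕ} {φ : ℝ → ℝ} {z : Cn n}
    (hφ : DifferentiableAt ℝ φ (‖z‖ ^ 2)) (k : Fin n) :
    wirtingerBar k (fun w => ((φ (‖w‖ ^ 2) : ℝ) : ℂ)) z = deriv φ (‖z‖ ^ 2) * z k := by
  have h : HasFDerivAt (fun w : Cn n => ((φ (‖w‖ ^ 2) : ℝ) : ℂ)) _ z :=
    (ofRealCLM.hasFDerivAt).comp z (hasFDerivAt_comp_norm_sq hφ)
  rw [wirtingerBar, h.fderiv]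
  simp only [ContinuousLinearMap.comp_apply, smul_apply, innerSL_apply_apply,
    real_inner_eq_re, inner_single_one, inner_single_I]
  apply Complex.ext <;> simp <;> ring

theorem complexHessian_of_radial {n : ℕ} {Φ : Cn n → ℝ} {φ : ℝ → ℝ} {z : Cn n}
    (hφ : AnalyticAt ℝ φ (‖z‖ ^ 2)) (h : ∀ᶠ w in 𝓝 z, Φ w = φ (‖w‖ ^ 2)) (j k : Fin n) :
    complexHessian Φ z j k = deriv φ (‖z‖ ^ 2) * (if j = k then 1 else 0)
      + deriv (deriv φ) (‖z‖ ^ 2) * (conj (z j) * z k) := by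
  have h1 : wirtingerBar k (fun w => (Φ w : ℂ)) =ᶠ[𝓝 z]
      fun w => ((deriv φ (‖w‖ ^ 2) : ℝ) : ℂ) * w k := by
    filter_upwards [h.eventually_nhds, eventually_analyticAt_norm_sq hφ] with w hw hw2
    rw [← wirtingerBar_comp_norm_sq hw2.differentiableAt k, wirtingerBar, wirtingerBar,
      Filter.EventuallyEq.fderiv_eq (hw.mono fun u hu => congrArg _ hu)]
  have h2 : HasFDerivAt (fun w : Cn n => ((deriv φ (‖w‖ ^ 2) : ℝ) : ℂ)) _ z :=
    (ofRealCLM.hasFDerivAt).comp z (hasFDerivAt_comp_norm_sq hφ.deriv.differentiableAt)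
  have h3 : HasFDerivAt (fun w : Cn n => w k)
      ((EuclideanSpace.proj k : Cn n →L[ℂ] ℂ).restrictScalars ℝ) z :=
    ((EuclideanSpace.proj k : Cn n →L[ℂ] ℂ).restrictScalars ℝ).hasFDerivAt
  have h4 : HasFDerivAt (fun w : Cn n => ((deriv φ (‖w‖ ^ 2) : ℝ) : ℂ) * w k) _ z := h2.mul h3
  rw [complexHessian, wirtinger, h1.fderiv_eq, h4.fderiv]
  simp only [ContinuousLinearMap.comp_apply, smul_apply, innerSL_apply_apply,
    real_inner_eq_re, inner_single_one, inner_single_I, add_apply,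
    ContinuousLinearMap.coe_restrictScalars', PiLp.proj_apply, EuclideanSpace.single, PiLp.single_apply]
  by_cases hjk : j = k
  · subst hjk
    apply Complex.ext <;> simp <;> ring
  · have : ¬ k = j := fun h => hjk h.symm
    apply Complex.ext <;> simp [hjk, this] <;> ring

theorem kahlerForm_of_radial {n : ℕ} {Φ : Cn n → ℝ} {φ : ℝ → ℝ} {z : Cn n}
    (hφ : AnalyticAt ℝ φ (‖z‖ ^ 2)) (h : ∀ᶠ w in 𝓝 z, Φ w = φ (‖w‖ ^ 2)) (v w : Cn n) :
    kahlerForm Φ z v w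
      = (radialForm (deriv φ (‖z‖ ^ 2)) (deriv (deriv φ) (‖z‖ ^ 2)) z v w : ℂ) := by
  set a := deriv φ (‖z‖ ^ 2)
  set b := deriv (deriv φ) (‖z‖ ^ 2)
  have e : kahlerForm Φ z v w = (I / 2) * (a * (inner ℂ w v - inner ℂ v w)
      + b * (inner ℂ z v * inner ℂ w z - inner ℂ z w * inner ℂ v z)) := by
    rw [inner_eq_sum_conj_mul w v, inner_eq_sum_conj_mul v w, inner_eq_sum_conj_mul z v,
      inner_eq_sum_conj_mul z w, Finset.sum_mul, Finset.sum_mul, ← Finset.sum_sub_distrib,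
      ← Finset.sum_sub_distrib, Finset.mul_sum, Finset.mul_sum, ← Finset.sum_add_distrib,
      Finset.mul_sum, kahlerForm, Finset.mul_sum]
    refine Finset.sum_congr rfl fun j _ => ?_
    simp only [complexHessian_of_radial hφ h]
    have : ∀ k, I / 2 * ((a * (if j = k then 1 else 0) + b * (conj (z j) * z k)) *
        (v j * conj (w k) - w j * conj (v k)))
        = (if j = k then I / 2 * (a * (conj (w j) * v j - conj (v j) * w j)) else 0)
          + I / 2 * (b * (conj (z j) * v j * (conj (w k) * z k)
            - conj (z j) * w j * (conj (v k) * z k))) := by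
      intro k
      split_ifs with hjk
      · subst hjk; ring
      · ring
    simp only [a, b] at this ⊢
    rw [Finset.mul_sum, Finset.sum_congr rfl fun k _ => this k, Finset.sum_add_distrib,
      Finset.sum_ite_eq, if_pos (Finset.mem_univ j), ← Finset.mul_sum, ← Finset.mul_sum,
      Finset.sum_sub_distrib, ← Finset.mul_sum, ← Finset.mul_sum, inner_eq_sum_conj_mul w z,
      inner_eq_sum_conj_mul v z, mul_add]
  rw [e, ← inner_conj_symm w v, ← inner_conj_symm w z, ← inner_conj_symm v z, radialForm]
  generalize inner ℂ v w = c₁, inner ℂ z v = c₂, inner ℂ z w = c₃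
  apply Complex.ext
  · simp
    ring
  · simp [mul_comm]

theorem analyticAt_norm_sq {n : ℕ} (z : Cn n) : AnalyticAt ℝ (fun w : Cn n => ‖w‖ ^ 2) z :=
  ((contDiff_norm_sq ℝ).contDiffAt (n := ω)).analyticAt

theorem analyticOnNhd_kahlerForm {n : ℕ} {Φ : Cn n → ℝ} {M : Set (Cn n)}
    (hΦ : AnalyticOnNhd ℝ Φ M) (v w : Cn n) :
    AnalyticOnNhd ℝ (fun z => kahlerForm Φ z v w) M := by
  have hc : AnalyticOnNhd ℝ (fun z => (Φ z : ℂ)) M := fun z hz =>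
    (ofRealCLM.analyticAt _).comp (hΦ z hz)
  have key : ∀ (g : Cn n → ℂ), AnalyticOnNhd ℝ g M → ∀ u : Cn n,
      AnalyticOnNhd ℝ (fun z => fderiv ℝ g z u) M := fun g hg u z hz =>
    ((ContinuousLinearMap.apply ℝ ℂ u).analyticAt _).comp (hg z hz).fderiv
  have hb : ∀ k, AnalyticOnNhd ℝ (wirtingerBar k fun z => (Φ z : ℂ)) M := fun k z hz =>
    analyticAt_const.mul ((key _ hc _ z hz).add (analyticAt_const.mul (key _ hc _ z hz)))
  have hh : ∀ j k, AnalyticOnNhd ℝ (fun z => complexHessian Φ z j k) M := fun j k z hz =>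
    analyticAt_const.mul ((key _ (hb k) _ z hz).sub (analyticAt_const.mul (key _ (hb k) _ z hz)))
  intro z hz
  refine analyticAt_const.mul (Finset.analyticAt_fun_sum _ fun j _ =>
    Finset.analyticAt_fun_sum _ fun k _ => (hh j k z hz).mul analyticAt_const)

/-! ### The dual of a radial potential -/

theorem biMonomial_mul_mul {n : ℕ} (p : (Fin n → ℕ) × (Fin n → ℕ)) (z u : Fin n → ℂ) (s t : ℂ) :
    biMonomial p (fun j => s * z j) (fun j => t * u j)
      = s ^ (∑ j, p.1 j) * t ^ (∑ j, p.2 j) * biMonomial p z u := by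
  simp only [biMonomial, mul_pow, Finset.prod_mul_distrib, Finset.prod_pow_eq_pow_sum]
  ring

theorem norm_biMonomial {n : ℕ} (p : (Fin n → ℕ) × (Fin n → ℕ)) (z u : Fin n → ℂ) :
    ‖biMonomial p z u‖ = ‖biMonomial p (fun j => (‖z j‖ : ℂ)) (fun j => (‖u j‖ : ℂ))‖ := by
  simp [biMonomial]

/-- A double series with `∑ dₚ s^aₚ s̄^bₚ = F(|s|²)` also satisfies `∑ dₚ (-1)^bₚ = F(-1)`: for
fixed `|s|` the left side is constant in the phase of `s`, hence also in a complexified phase, which gives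
`∑ dₚ t^bₚ = F(t)` first for `t > 0` and then, by analyticity, for `t = -1`. -/
theorem tsum_neg_one_pow_eq_of_polarized {ι : Type*} {d : ι → ℂ} {a b : ι → ℕ} {F : ℝ → ℝ}
    (hd : Summable fun p => ‖d p‖ * 4 ^ (a p + b p))
    (hF : AnalyticOnNhd ℝ F (Ioo (-2) 2))
    (h : ∀ s : ℂ, ‖s‖ < 2 → ∑' p, d p * (s ^ a p * conj s ^ b p) = F (‖s‖ ^ 2)) :
    ∑' p, d p * (-1) ^ b p = F (-1) := by
  have hl2 : 0 < Real.log 2 := Real.log_pos (by norm_num)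
  -- `t > 0` is `s * s'` with `s = exp (ℓ + w)`, `s' = exp (ℓ - w)`, where `ℓ = (log t) / 2`; the
  -- hypothesis is the case `w ∈ iℝ`, and `w = -ℓ` gives `s = 1`, `s' = t`.
  have key : ∀ l : ℝ, |l| < Real.log 2 →
      ∑' p, d p * (Real.exp (2 * l) : ℂ) ^ b p = F (Real.exp (2 * l)) := by
    intro l hl
    set K : ℂ → ℂ := fun w => ∑' p, d p * (cexp (l + w) ^ a p * cexp (l - w) ^ b p) with hK
    set Ω : Set ℂ := {w | w.re ∈ Ioo (-Real.log 2) (Real.log 2)} with hΩ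
    have hΩo : IsOpen Ω := isOpen_Ioo.preimage continuous_re
    have hΩc : IsPreconnected Ω := ((convex_Ioo _ _).linear_preimage reLm).isPreconnected
    have hexp : ∀ x : ℝ, x < 2 * Real.log 2 → Real.exp x ≤ 4 := by
      intro x hx
      have h4 : Real.exp (2 * Real.log 2) = 4 := by
        rw [two_mul, Real.exp_add, Real.exp_log (by norm_num)]; norm_num
      exact h4 ▸ Real.exp_le_exp.2 hx.le
    have hKd : DifferentiableOn ℂ K Ω := by
      refine differentiableOn_tsum_of_summable_norm hd (fun p => ?_) hΩo fun p w hw => ?_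
      · exact Differentiable.differentiableOn (by fun_prop)
      · rw [norm_mul, norm_mul, norm_pow, norm_pow, norm_exp, norm_exp, pow_add]
        have h1 := hw.1
        have h2 := hw.2
        have h3 := (abs_lt.1 hl).2
        refine mul_le_mul_of_nonneg_left (mul_le_mul ?_ ?_ (by positivity) (by positivity))
          (norm_nonneg _)
        · exact pow_le_pow_left₀ (Real.exp_pos _).le (hexp _ (by simp; linarith)) _
        · exact pow_le_pow_left₀ (Real.exp_pos _).le (hexp _ (by simp; linarith)) _
    have hline : ∀ θ : ℝ, K (I * θ) = F (Real.exp (2 * l)) := by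
      intro θ
      have hn : ‖cexp (l + I * θ)‖ = Real.exp l := by simp [norm_exp]
      have h1 := h (cexp (l + I * θ)) (by
        rw [hn, ← Real.exp_log (show (0 : ℝ) < 2 by norm_num)]
        exact Real.exp_lt_exp.2 (abs_lt.1 hl).2)
      rw [hn, ← Real.exp_nat_mul] at h1
      rw [hK]
      simp only [← exp_conj] at h1
      simp only [map_add, map_mul, conj_I, conj_ofReal, neg_mul] at h1
      simpa [sub_eq_add_neg] using h1
    have hfreq : ∃ᶠ w in 𝓝[≠] (0 : ℂ), K w = F (Real.exp (2 * l)) := by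
      have ht : Tendsto (fun θ : ℝ => I * θ) (𝓝[≠] 0) (𝓝[≠] 0) := by
        refine tendsto_nhdsWithin_iff.2 ⟨?_, ?_⟩
        · have : Tendsto (fun θ : ℝ => I * (θ : ℂ)) (𝓝 0) (𝓝 (I * ((0 : ℝ) : ℂ))) :=
            (by fun_prop : Continuous fun θ : ℝ => I * (θ : ℂ)).tendsto 0
          simp only [ofReal_zero, mul_zero] at this
          exact this.mono_left nhdsWithin_le_nhds
        · filter_upwards [self_mem_nhdsWithin] with θ hθ
          simpa using hθ
      exact ht.frequently (Frequently.of_forall hline)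
    have h0 : (0 : ℂ) ∈ Ω := by simp [hΩ, hl2]
    have hl' : (-(l : ℂ)) ∈ Ω := by
      have := abs_lt.1 hl
      simp only [hΩ, mem_ofPred_eq, neg_re, ofReal_re, mem_Ioo]
      exact ⟨by linarith, by linarith⟩
    have := (hKd.analyticOnNhd hΩo).eqOn_of_preconnected_of_frequently_eq analyticOnNhd_const
      hΩc h0 hfreq hl'
    simpa [hK, two_mul, sub_eq_add_neg] using this
  have hm : AnalyticOnNhd ℂ (fun t : ℂ => ∑' p, d p * t ^ b p) (Metric.ball 0 2) := by
    refine DifferentiableOn.analyticOnNhd ?_ Metric.isOpen_ball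
    refine differentiableOn_tsum_of_summable_norm hd (fun p => ?_) Metric.isOpen_ball
      fun p t ht => ?_
    · exact Differentiable.differentiableOn (by fun_prop)
    · rw [norm_mul, norm_pow, pow_add]
      have h1 : ‖t‖ ≤ 4 := by
        rw [mem_ball_zero_iff] at ht
        linarith
      refine mul_le_mul_of_nonneg_left ?_ (norm_nonneg _)
      calc ‖t‖ ^ b p ≤ 4 ^ b p := pow_le_pow_left₀ (norm_nonneg _) h1 _
        _ ≤ 4 ^ a p * 4 ^ b p := le_mul_of_one_le_left (by positivity) (one_le_pow₀ (by norm_num))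
  have hm' : AnalyticOnNhd ℝ (fun t : ℝ => ∑' p, d p * (t : ℂ) ^ b p) (Ioo (-2) 2) := by
    intro t ht
    have h1 : (t : ℂ) ∈ Metric.ball (0 : ℂ) 2 := by
      simpa [abs_lt] using ht
    exact ((hm _ h1).restrictScalars (𝕜 := ℝ)).comp (ofRealCLM.analyticAt t)
  have hF' : AnalyticOnNhd ℝ (fun t : ℝ => (F t : ℂ)) (Ioo (-2) 2) := fun t ht =>
    (ofRealCLM.analyticAt _).comp (hF t ht)
  have hnear : (fun t : ℝ => ∑' p, d p * (t : ℂ) ^ b p) =ᶠ[𝓝 1] fun t => (F t : ℂ) := by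
    filter_upwards [Ioo_mem_nhds (show (1 / 2 : ℝ) < 1 by norm_num) (show (1 : ℝ) < 2 by norm_num)]
      with t ht
    have h0 : 0 < t := by linarith [ht.1]
    have h1 := key (Real.log t / 2) (by
      have e1 : Real.log t < Real.log 2 := Real.log_lt_log h0 ht.2
      have e2 : -Real.log 2 < Real.log t := by
        rw [← Real.log_inv]; exact Real.log_lt_log (by norm_num) (by linarith [ht.1])
      rw [abs_lt]; constructor <;> linarith)
    rwa [mul_div_cancel₀ _ (two_ne_zero), Real.exp_log h0] at h1
  have := hm'.eqOn_of_preconnected_of_eventuallyEq hF' isPreconnected_Ioo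
    (show (1 : ℝ) ∈ Ioo (-2) 2 by norm_num) hnear (show (-1 : ℝ) ∈ Ioo (-2) 2 by norm_num)
  simpa using this

/-- The local dual of `f(|z|²)` is `-f(-|z|²)` near the origin. -/
theorem IsLocalDual.eventually_eq_neg {n : ℕ} {Φ Φstar : Cn n → ℝ} {Mstar : Set (Cn n)}
    {f : ℝ → ℝ} (hdual : IsLocalDual Φ Mstar Φstar) (hf : AnalyticAt ℝ f 0)
    (hΦ : ∀ᶠ z : Cn n in 𝓝 0, Φ z = f (‖z‖ ^ 2)) :
    ∀ᶠ z : Cn n in 𝓝 0, Φstar z = -f (-‖z‖ ^ 2) := by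
  obtain ⟨-, -, c, hc, hcs⟩ := hdual
  obtain ⟨ε, hε, hball⟩ := Metric.eventually_nhds_iff_ball.1 (hc.and hΦ)
  obtain ⟨δ, hδ, hfb⟩ := Metric.eventually_nhds_iff_ball.1 hf.eventually_analyticAt
  have hsmall : ∀ᶠ z : Cn n in 𝓝 0, ‖z‖ < ε / 4 :=
    (continuous_norm.tendsto (0 : Cn n)).eventually (gt_mem_nhds (by simpa using by linarith))
  have hsmall' : ∀ᶠ z : Cn n in 𝓝 0, ‖z‖ ^ 2 < δ / 2 :=
    ((by fun_prop : Continuous fun z : Cn n => ‖z‖ ^ 2).tendsto (0 : Cn n)).eventually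
      (gt_mem_nhds (by simpa using hδ))
  filter_upwards [hcs, hsmall, hsmall'] with z hz hz1 hz2
  set u : Fin n → ℂ := fun j => conj (z j) with hu
  have hx : 0 ≤ ‖z‖ ^ 2 := by positivity
  have hsum : Summable fun p : (Fin n → ℕ) × (Fin n → ℕ) =>
      ‖c p * biMonomial p z u‖ * 4 ^ (∑ j, p.1 j + ∑ j, p.2 j) := by
    -- absolute convergence on the polydisc of radii `4 |z_j|`
    let z' : Cn n := WithLp.toLp 2 fun j => ((4 * ‖z j‖ : ℝ) : ℂ)
    have hz'n : ‖z'‖ = 4 * ‖z‖ := by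
      have e1 : ‖z'‖ ^ 2 = (4 * ‖z‖) ^ 2 := by
        rw [mul_pow, EuclideanSpace.norm_sq_eq, EuclideanSpace.norm_sq_eq, Finset.mul_sum]
        exact Finset.sum_congr rfl fun j _ => by simp [z', mul_pow]
      exact (pow_left_inj₀ (norm_nonneg _) (by positivity) two_ne_zero).1 e1
    have h1 := (hball z' (by rw [mem_ball_zero_iff, hz'n]; linarith)).1.summable.norm
    refine h1.congr fun p => ?_
    rw [norm_mul, norm_mul, norm_biMonomial p z u, mul_assoc]
    congr 1
    have e2 : biMonomial p z' (fun j => conj (z' j))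
        = biMonomial p (fun j => (4 : ℂ) * (‖z j‖ : ℂ)) (fun j => (4 : ℂ) * (‖u j‖ : ℂ)) := by
      simp [z', hu, Complex.conj_ofNat]
    rw [e2, biMonomial_mul_mul, norm_mul, norm_mul, norm_pow, norm_pow, ← pow_add, mul_comm]
    norm_num
  have hFan : AnalyticOnNhd ℝ (fun t : ℝ => f (t * ‖z‖ ^ 2)) (Ioo (-2) 2) := by
    intro t ht
    have h1 : t * ‖z‖ ^ 2 ∈ Metric.ball (0 : ℝ) δ := by
      rw [mem_ball_zero_iff, Real.norm_eq_abs, abs_mul, abs_of_nonneg hx]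
      have : |t| < 2 := abs_lt.2 ht
      nlinarith
    exact AnalyticAt.fun_comp (hfb _ h1) (analyticAt_id.mul analyticAt_const)
  have hpol : ∀ s : ℂ, ‖s‖ < 2 → ∑' p : (Fin n → ℕ) × (Fin n → ℕ),
      c p * biMonomial p z u * (s ^ (∑ j, p.1 j) * conj s ^ (∑ j, p.2 j))
        = (fun t : ℝ => f (t * ‖z‖ ^ 2)) (‖s‖ ^ 2) := by
    intro s hs
    have h1 : s • z ∈ Metric.ball (0 : Cn n) ε := by
      rw [mem_ball_zero_iff, norm_smul]
      nlinarith [norm_nonneg z, norm_nonneg s]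
    obtain ⟨h2, h3⟩ := hball _ h1
    rw [h3, norm_smul, mul_pow] at h2
    rw [← h2.tsum_eq]
    refine tsum_congr fun p => ?_
    have e : biMonomial p (s • z).ofLp (fun j => conj ((s • z) j))
        = biMonomial p (fun j => s * z j) (fun j => conj s * u j) := by
      simp [biMonomial, hu]
    rw [e, biMonomial_mul_mul]
    ring
  have h := tsum_neg_one_pow_eq_of_polarized hsum hFan hpol
  have e : ∀ p, biMonomial p z (fun j => -conj (z j)) = (-1) ^ (∑ j, p.2 j) * biMonomial p z u := by
    intro p
    have := biMonomial_mul_mul p z u 1 (-1)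
    simpa [hu] using this
  rw [← neg_eq_iff_eq_neg]
  have h2 := hz.tsum_eq
  simp only [e] at h2
  have h3 : ((-Φstar z : ℝ) : ℂ) = ((f (-1 * ‖z‖ ^ 2) : ℝ) : ℂ) := by
    rw [← h2, ← h]
    exact tsum_congr fun p => by ring
  have := ofReal_injective h3
  simpa using this

/-! ### Functions of one real variable -/

theorem AnalyticAt.eventually_eq_of_deriv_eq_zero {g : ℝ → ℝ} {a : ℝ} (hg : AnalyticAt ℝ g a)
    (h : ∀ᶠ x in 𝓝 a, deriv g x = 0) : ∀ᶠ x in 𝓝 a, g x = g a := by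
  obtain ⟨ε, hε, hb⟩ := Metric.eventually_nhds_iff_ball.1 (h.and hg.eventually_analyticAt)
  filter_upwards [Metric.ball_mem_nhds a hε] with x hx
  exact Metric.isOpen_ball.is_const_of_deriv_eq_zero (convex_ball a ε).isPreconnected
    (fun y hy => (hb y hy).2.differentiableAt.differentiableWithinAt)
    (fun y hy => (hb y hy).1) hx (Metric.mem_ball_self hε)

/-- If `n φ' + y φ''` is constant then so is `φ'`: multiply by `yⁿ⁻¹` and integrate. Up to a factor
the left side is the trace of the Kähler form of `φ(|z|²)`. -/
theorem eventually_deriv_eq_of_trace_eq_const {n : ℕ} (hn : n ≠ 0) {φ : ℝ → ℝ}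
    (hφ : AnalyticAt ℝ φ 0) {c : ℝ}
    (h : ∀ᶠ y in 𝓝 (0 : ℝ), n * deriv φ y + y * deriv (deriv φ) y = c) :
    ∀ᶠ y in 𝓝 (0 : ℝ), deriv φ y = deriv φ 0 := by
  have hn' : (n : ℝ) ≠ 0 := by exact_mod_cast hn
  have hG : AnalyticAt ℝ (fun y => y ^ n * (deriv φ y - c / n)) 0 :=
    (analyticAt_id.pow n).mul (hφ.deriv.sub analyticAt_const)
  have hG' : ∀ᶠ y in 𝓝 (0 : ℝ), deriv (fun y => y ^ n * (deriv φ y - c / n)) y = 0 := by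
    filter_upwards [h, hφ.eventually_analyticAt] with y hy hφy
    have h1 := (hasDerivAt_pow n y).mul (hφy.deriv.differentiableAt.hasDerivAt.sub_const (c / n))
    have h2 : deriv (fun y => y ^ n * (deriv φ y - c / n)) y = _ := h1.deriv
    rw [h2, ← hy]
    obtain ⟨m, rfl⟩ := Nat.exists_eq_succ_of_ne_zero hn
    simp only [Nat.succ_eq_add_one, Nat.add_sub_cancel] at *
    field_simp
    ring
  have h0 := h.self_of_nhds
  have h00 : deriv φ 0 = c / n := by
    rw [eq_div_iff hn']; linarith
  filter_upwards [hG.eventually_eq_of_deriv_eq_zero hG'] with y hy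
  rw [h00]
  by_cases hy0 : y = 0
  · rw [hy0, h00]
  · simpa [hn, hy0, sub_eq_zero] using hy

theorem AnalyticAt.exists_injOn_Ico {T : ℝ → ℝ} (hT : AnalyticAt ℝ T 0)
    (h : ¬ ∀ᶠ y in 𝓝 (0 : ℝ), T y = T 0) : ∃ ε > 0, InjOn T (Ico 0 ε) := by
  have h1 : ∀ᶠ y in 𝓝[≠] (0 : ℝ), deriv T y ≠ 0 :=
    hT.deriv.eventually_eq_zero_or_eventually_ne_zero.resolve_left fun h' =>
      h (hT.eventually_eq_of_deriv_eq_zero h')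
  obtain ⟨ε, hε, hb⟩ := Metric.eventually_nhds_iff_ball.1
    ((eventually_nhdsWithin_iff.1 h1).and hT.eventually_analyticAt)
  have hball : ∀ y ∈ Ico 0 ε, y ∈ Metric.ball (0 : ℝ) ε := fun y hy => by
    rw [mem_ball_zero_iff, Real.norm_eq_abs, abs_of_nonneg hy.1]; exact hy.2
  have key : ∀ a ∈ Ico 0 ε, ∀ b ∈ Ico 0 ε, a < b → T a ≠ T b := by
    intro a ha b hb' hab heq
    obtain ⟨c, hc, hc'⟩ := exists_deriv_eq_zero hab (fun y hy =>
      (hb y (hball y ⟨ha.1.trans hy.1, hy.2.trans_lt hb'.2⟩)).2.continuousAt.continuousWithinAt) heq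
    exact (hb c (hball c ⟨ha.1.trans hc.1.le, hc.2.trans hb'.2⟩)).1 (ha.1.trans_lt hc.1).ne' hc'
  refine ⟨ε, hε, fun a ha b hb' heq => ?_⟩
  rcases lt_trichotomy a b with hab | hab | hab
  · exact absurd heq (key a ha b hb' hab)
  · exact hab
  · exact absurd heq.symm (key b hb' a ha hab)

/-- With `h(x) = x f'(x)`, the equation `λ² h'(x) h'(-λ h(x)) = 1` says that `-λ h` is an involution
up to an additive constant, and the constant vanishes because `h(0) = 0`. -/
theorem eventually_mul_deriv_eq_one {f : ℝ → ℝ} (hf : AnalyticAt ℝ f 0) {lam : ℝ}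
    (h : ∀ᶠ x in 𝓝[>] (0 : ℝ), lam ^ 2 * (deriv f x + x * deriv (deriv f) x) *
      (deriv f (-(lam * x * deriv f x))
        + -(lam * x * deriv f x) * deriv (deriv f) (-(lam * x * deriv f x))) = 1) :
    ∀ᶠ x in 𝓝 (0 : ℝ), lam ^ 2 * deriv f x * deriv f (-(lam * x * deriv f x)) = 1 := by
  have hs : AnalyticAt ℝ (fun x => -(lam * x * deriv f x)) 0 :=
    ((analyticAt_const.mul analyticAt_id).mul hf.deriv).neg
  have hs0 : -(lam * 0 * deriv f 0) = 0 := by ring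
  have hcomp : ∀ {g : ℝ → ℝ}, AnalyticAt ℝ g 0 →
      AnalyticAt ℝ (fun x => g (-(lam * x * deriv f x))) 0 := fun hg =>
    AnalyticAt.fun_comp (by rwa [hs0]) hs
  have h' := ((((analyticAt_const.mul (hf.deriv.add (analyticAt_id.mul hf.deriv.deriv))).mul
    ((hcomp hf.deriv).add (hs.mul (hcomp hf.deriv.deriv)))).frequently_eq_iff_eventually_eq
      analyticAt_const).1 (h.frequently.filter_mono (nhdsWithin_mono _ fun x hx => ne_of_gt hx)))
  have hst : ∀ᶠ x in 𝓝 (0 : ℝ), AnalyticAt ℝ f (-(lam * x * deriv f x)) := by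
    have := hs.continuousAt.tendsto
    rw [hs0] at this
    exact this.eventually hf.eventually_analyticAt
  have hG : AnalyticAt ℝ (fun x =>
      lam * (-(lam * x * deriv f x) * deriv f (-(lam * x * deriv f x))) + x) 0 :=
    (analyticAt_const.mul (hs.mul (hcomp hf.deriv))).add analyticAt_id
  have hGd : ∀ᶠ x in 𝓝 (0 : ℝ), deriv (fun x =>
      lam * (-(lam * x * deriv f x) * deriv f (-(lam * x * deriv f x))) + x) x = 0 := by
    filter_upwards [h', hf.eventually_analyticAt, hst] with x hx h1 h2
    have d1 : HasDerivAt (fun x => -(lam * x * deriv f x)) _ x :=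
      (((hasDerivAt_id' x).const_mul lam).mul h1.deriv.differentiableAt.hasDerivAt).neg
    have d2 : HasDerivAt (fun x => deriv f (-(lam * x * deriv f x))) _ x :=
      HasDerivAt.comp x (h₂ := deriv f) h2.deriv.differentiableAt.hasDerivAt d1
    refine (((d1.mul d2).const_mul lam).add (hasDerivAt_id' x)).deriv.trans ?_
    simp only [Pi.mul_apply, Pi.add_apply, id] at hx
    linear_combination -hx
  have hE : AnalyticAt ℝ (fun x => lam ^ 2 * deriv f x * deriv f (-(lam * x * deriv f x))) 0 :=
    (analyticAt_const.mul hf.deriv).mul (hcomp hf.deriv)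
  refine (hE.frequently_eq_iff_eventually_eq analyticAt_const).1 (Eventually.frequently ?_)
  filter_upwards [(hG.eventually_eq_of_deriv_eq_zero hGd).filter_mono nhdsWithin_le_nhds,
    self_mem_nhdsWithin] with x hx hx0
  have h0 : x * (1 - lam ^ 2 * deriv f x * deriv f (-(lam * x * deriv f x))) = 0 := by
    linear_combination hx
  linarith [(mul_eq_zero.1 h0).resolve_left hx0]

/-! ### The trace of the dual form -/

theorem inner_I_smul_left {n : ℕ} (v w : Cn n) : inner ℂ (I • v) w = -I * inner ℂ v w := by
  rw [inner_smul_left, conj_I]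

theorem inner_I_smul_right {n : ℕ} (v w : Cn n) : inner ℂ v (I • w) = I * inner ℂ v w :=
  inner_smul_right _ _ _

theorem inner_self_eq_norm_sq_ofReal {n : ℕ} (z : Cn n) : inner ℂ z z = ((‖z‖ ^ 2 : ℝ) : ℂ) := by
  rw [inner_self_eq_norm_sq_to_K]; simp

theorem eq_of_forall_im_inner_eq {n : ℕ} {u v : Cn n}
    (h : ∀ w : Cn n, (inner ℂ u w).im = (inner ℂ v w).im) : u = v := by
  rw [← sub_eq_zero, ← norm_eq_zero, ← sq_eq_zero_iff]
  have h1 := h (I • (u - v))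
  rw [inner_I_smul_right, inner_I_smul_right, ← sub_eq_zero, ← Complex.sub_im, ← mul_sub,
    ← inner_sub_left, inner_self_eq_norm_sq_ofReal, I_mul_im, ofReal_re] at h1
  exact h1

theorem sum_norm_sq_inner_orthonormalBasis_real {n : ℕ} {ι : Type*} [Fintype ι]
    (e : OrthonormalBasis ι ℝ (Cn n)) (z : Cn n) :
    ∑ i, ‖inner ℂ z (e i)‖ ^ 2 = 2 * ‖z‖ ^ 2 := by
  have h1 := e.sum_sq_inner_left z
  have h2 := e.sum_sq_inner_left (I • z)
  rw [norm_smul, norm_I, one_mul] at h2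
  rw [two_mul]
  nth_rw 1 [← h1]
  rw [← h2, ← Finset.sum_add_distrib]
  refine Finset.sum_congr rfl fun i _ => ?_
  rw [real_inner_eq_re, real_inner_eq_re, inner_I_smul_left, ← normSq_eq_norm_sq, normSq_apply]
  simp
  ring

theorem card_orthonormalBasis_real {n : ℕ} {ι : Type*} [Fintype ι]
    (e : OrthonormalBasis ι ℝ (Cn n)) : (Fintype.card ι : ℝ) = 2 * n := by
  have h1 := Module.finrank_eq_card_basis e.toBasis
  have h2 : Module.finrank ℝ (Cn n) = 2 * n := by
    rw [← Module.finrank_mul_finrank ℝ ℂ (Cn n)]; simp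
  rw [← h1, h2]; push_cast; ring

/-- The trace, with respect to the flat metric, of the form `a ω₀ + b (i/2) ∂|z|² ∧ ∂̄|z|²`. -/
theorem sum_radialForm_I_smul {n : ℕ} {ι : Type*} [Fintype ι]
    (e : OrthonormalBasis ι ℝ (Cn n)) (a b : ℝ) (z : Cn n) :
    ∑ i, radialForm a b z (e i) (I • e i) = 2 * (n * a + b * ‖z‖ ^ 2) := by
  have h : ∀ i, radialForm a b z (e i) (I • e i) = a + b * ‖inner ℂ z (e i)‖ ^ 2 := by
    intro i
    rw [radialForm, inner_I_smul_right, inner_I_smul_right, inner_self_eq_norm_sq_ofReal,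
      e.norm_eq_one, ← normSq_eq_norm_sq, normSq_apply]
    generalize inner ℂ z (e i) = c
    simp
  rw [Finset.sum_congr rfl fun i _ => h i, Finset.sum_add_distrib, ← Finset.mul_sum,
    sum_norm_sq_inner_orthonormalBasis_real, Finset.sum_const, nsmul_eq_mul, Finset.card_univ,
    card_orthonormalBasis_real e]
  ring

/-- Write `λ (a ω₀ + b (i/2) ∂|z|² ∧ ∂̄|z|²) = ω₀(A ·, ·)`. If `L` pulls `ω₀` back to this form
and pulls `λ β` back to `ω₀`, then `λ β = ω₀(L A⁻¹ L⁻¹ ·, ·)`, so the trace of `λ β` is that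
of `A⁻¹`. -/
theorem sum_dual_I_smul_eq {n : ℕ} {ι : Type*} [Fintype ι]
    (e : OrthonormalBasis ι ℝ (Cn n)) {a b lam : ℝ} {z : Cn n} (hlam : lam ≠ 0) (ha : a ≠ 0)
    (hab : a + b * ‖z‖ ^ 2 ≠ 0) (L : Cn n →L[ℝ] Cn n) (β : Cn n → Cn n → ℂ)
    (h1 : ∀ v w, (inner ℂ (L v) (L w)).im = lam * radialForm a b z v w)
    (h2 : ∀ v w, lam * β (L v) (L w) = ((inner ℂ v w).im : ℂ)) :
    lam * ∑ i, β (e i) (I • e i)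
      = ((2 * (n / (lam * a) - b * ‖z‖ ^ 2 / (lam * a * (a + b * ‖z‖ ^ 2))) : ℝ) : ℂ) := by
  set c : ℝ := b / (lam * a * (a + b * ‖z‖ ^ 2)) with hc
  have hinj : Function.Injective (L : Cn n →ₗ[ℝ] Cn n) := by
    rw [← LinearMap.ker_eq_bot, LinearMap.ker_eq_bot']
    intro v hv
    refine eq_of_forall_im_inner_eq fun w => ?_
    have e1 := h2 v w
    have e2 := h2 0 w
    have hv' : L v = L 0 := by rw [map_zero]; exact hv
    rw [hv', e2] at e1
    exact_mod_cast e1.symm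
  let E : Cn n ≃ₗ[ℝ] Cn n := LinearEquiv.ofInjectiveEndo _ hinj
  have hE : ∀ v, E v = L v := fun v => rfl
  let A' : Cn n →ₗ[ℝ] Cn n :=
    { toFun := fun v => ((lam * a)⁻¹ : ℝ) • v - (c * inner ℂ z v : ℂ) • z
      map_add' := fun u v => by simp only [inner_add_right, mul_add, add_smul, smul_add]; abel
      map_smul' := fun t v => by
        have : inner ℂ z (t • v) = t * inner ℂ z v := by
          rw [← Complex.coe_smul, inner_smul_right]
        rw [this, RingHom.id_apply, smul_sub, smul_comm t (lam * a)⁻¹ v, mul_left_comm,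
          mul_smul (t : ℂ), Complex.coe_smul] }
  have hA' : ∀ v w, lam * radialForm a b z (A' v) w = (inner ℂ v w).im := by
    intro v w
    have hab' : (a : ℂ) + b * (‖z‖ : ℂ) ^ 2 ≠ 0 := by exact_mod_cast hab
    have ha' : (a : ℂ) ≠ 0 := by exact_mod_cast ha
    have hl' : (lam : ℂ) ≠ 0 := by exact_mod_cast hlam
    have : (lam : ℂ) • ((a : ℂ) • A' v + ((b : ℂ) * inner ℂ z (A' v)) • z) = v := by
      have e1 : A' v = (((lam * a)⁻¹ : ℝ) : ℂ) • v - (c * inner ℂ z v : ℂ) • z := by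
        rw [Complex.coe_smul]; rfl
      rw [e1, inner_sub_right, inner_smul_right, inner_smul_right, inner_self_eq_norm_sq_ofReal]
      have e2 : ∀ p q : ℂ, (lam : ℂ) • ((a : ℂ) • (p • v - q • z) + (b * (p * inner ℂ z v
          - q * ((‖z‖ ^ 2 : ℝ) : ℂ))) • z) = (lam * a * p) • v
            + (lam * (b * (p * inner ℂ z v) - q * (a + b * ((‖z‖ ^ 2 : ℝ) : ℂ)))) • z := by
        intro p q; module
      rw [e2]
      have e3 : (lam : ℂ) * a * (((lam * a)⁻¹ : ℝ) : ℂ) = 1 := by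
        push_cast; field_simp
      have e4 : (b : ℂ) * ((((lam * a)⁻¹ : ℝ) : ℂ) * inner ℂ z v)
          - c * inner ℂ z v * (a + b * ((‖z‖ ^ 2 : ℝ) : ℂ)) = 0 := by
        rw [hc]; push_cast; field_simp; ring
      rw [e3, e4, mul_zero, zero_smul, one_smul, add_zero]
    rw [radialForm_eq_im_inner]
    conv_rhs => rw [← this]
    rw [inner_smul_left, conj_ofReal, im_ofReal_mul]
  have hβ : ∀ v w, lam * β v w = ((inner ℂ (E.conj A' v) w).im : ℂ) := by
    intro v w
    obtain ⟨v, rfl⟩ := E.surjective v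
    obtain ⟨w, rfl⟩ := E.surjective w
    rw [LinearEquiv.conj_apply_apply, E.symm_apply_apply, hE, hE, hE, h2, h1, hA']
  have htr : LinearMap.trace ℝ (Cn n) A' = 2 * (n / (lam * a) - c * ‖z‖ ^ 2) := by
    rw [LinearMap.trace_eq_sum_inner _ e]
    have h : ∀ i, inner ℝ (e i) (A' (e i)) = (lam * a)⁻¹ - c * ‖inner ℂ z (e i)‖ ^ 2 := by
      intro i
      have e1 : A' (e i) = ((lam * a)⁻¹ : ℝ) • e i - (c * inner ℂ z (e i) : ℂ) • z := rfl
      rw [e1, inner_sub_right, real_inner_smul_right, real_inner_self_eq_norm_sq, e.norm_eq_one,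
        real_inner_eq_re, inner_smul_right, ← inner_conj_symm (e i) z, mul_assoc, mul_conj,
        normSq_eq_norm_sq, ← ofReal_mul, ofReal_re]
      ring
    rw [Finset.sum_congr rfl fun i _ => h i, Finset.sum_sub_distrib, ← Finset.mul_sum,
      sum_norm_sq_inner_orthonormalBasis_real, Finset.sum_const, nsmul_eq_mul, Finset.card_univ,
      card_orthonormalBasis_real e]
    ring
  rw [Finset.mul_sum, Finset.sum_congr rfl fun i _ => hβ _ _, ← ofReal_sum]
  congr 1
  rw [mul_div_right_comm, ← hc, ← htr, ← LinearMap.trace_conj' A' E,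
    LinearMap.trace_eq_sum_inner _ e]
  refine Finset.sum_congr rfl fun i _ => ?_
  rw [real_inner_eq_re, inner_I_smul_right, ← inner_conj_symm (e i), I_mul_im, conj_re]

/-! ### Dualities fix the origin -/

theorem hasDerivAt_exp_mul_I_smul {n : ℕ} (c : ℝ) (z : Cn n) (t : ℝ) :
    HasDerivAt (fun t : ℝ => cexp ((c * t : ℝ) * I) • z)
      (c • (I • (cexp ((c * t : ℝ) * I) • z))) t := by
  have h1 : HasDerivAt (fun t : ℝ => ((c * t : ℝ) : ℂ)) (c : ℂ) t := by
    simpa using ((hasDerivAt_id t).const_mul c).ofReal_comp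
  have h2 := ((h1.mul_const I).cexp).smul_const z
  refine h2.congr_deriv ?_
  rw [← Complex.coe_smul, smul_smul, smul_smul]
  congr 1
  ring

theorem norm_exp_ofReal_mul_I_smul {n : ℕ} (t : ℝ) (z : Cn n) :
    ‖cexp ((t : ℝ) * I) • z‖ = ‖z‖ := by
  rw [norm_smul, norm_exp_ofReal_mul_I, one_mul]

theorem exists_norm_eq_one {n : ℕ} (hn : n ≠ 0) : ∃ e : Cn n, ‖e‖ = 1 :=
  ⟨EuclideanSpace.single ⟨0, Nat.pos_of_ne_zero hn⟩ 1, by simp⟩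

/-- A radial property of `ℂⁿ` near the origin gives a property of `[0, ε)`. -/
theorem eventually_nhdsGE_of_norm_sq {n : ℕ} (hn : n ≠ 0) {p : ℝ → Prop}
    (h : ∀ᶠ z : Cn n in 𝓝 0, p (‖z‖ ^ 2)) : ∀ᶠ x in 𝓝[≥] (0 : ℝ), p x := by
  obtain ⟨e, he⟩ := exists_norm_eq_one hn
  have ht : Tendsto (fun x : ℝ => Real.sqrt x • e) (𝓝[≥] 0) (𝓝 0) := by
    have : Tendsto (fun x : ℝ => Real.sqrt x • e) (𝓝 0) (𝓝 (Real.sqrt 0 • e)) :=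
      (by fun_prop : Continuous fun x : ℝ => Real.sqrt x • e).tendsto 0
    rw [Real.sqrt_zero, zero_smul] at this
    exact this.mono_left nhdsWithin_le_nhds
  filter_upwards [ht.eventually h, self_mem_nhdsWithin] with x hx hx0
  rwa [norm_smul, he, mul_one, Real.norm_eq_abs, sq_abs, Real.sq_sqrt hx0] at hx

/-- Let `Ψ` carry a radial function `S(|z|²)` to a real-analytic function `τ` which near the origin
is radial and not constant. Then `Ψ(0) = 0`: by analytic continuation `τ` is invariant under
rotations, so its level set through `Ψ(0)` contains an arc unless `Ψ(0) = 0`, while the level set of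
`S(|z|²)` through the origin is isolated. -/
theorem map_zero_of_radial_invariant {n : ℕ} {Ms U V : Set (Cn n)} {Ψ Θ : Cn n → Cn n}
    {τ : Cn n → ℂ} {T S : ℝ → ℝ} (hMs : IsOpen Ms) (hMc : IsPreconnected Ms) (h0 : (0 : Cn n) ∈ Ms)
    (hτ : AnalyticOnNhd ℝ τ Ms) (hτT : ∀ᶠ w : Cn n in 𝓝 0, τ w = (T (‖w‖ ^ 2) : ℂ))
    (hT : AnalyticAt ℝ T 0) (hTc : ¬ ∀ᶠ y in 𝓝 (0 : ℝ), T y = T 0)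
    (hS : AnalyticAt ℝ S 0) (hV : IsOpen V) (hVM : V ⊆ Ms) (h0U : (0 : Cn n) ∈ U)
    (hΨ : MapsTo Ψ U V) (hΘ : ContinuousOn Θ V) (hinv : InvOn Θ Ψ U V)
    (hτS : ∀ᶠ z : Cn n in 𝓝 0, τ (Ψ z) = (S (‖z‖ ^ 2) : ℂ)) : Ψ 0 = 0 := by
  by_contra hw0
  have hn : n ≠ 0 := by
    rintro rfl
    exact hw0 (Subsingleton.elim _ _)
  set w₀ := Ψ 0 with hw₀
  have hwV : w₀ ∈ V := hΨ h0U
  have hΘ0 : Θ w₀ = 0 := hinv.1 h0U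
  have hΘt : Tendsto Θ (𝓝 w₀) (𝓝 0) := by
    have := (hΘ.continuousAt (hV.mem_nhds hwV)).tendsto
    rwa [hΘ0] at this
  have hτΘ : ∀ᶠ w in 𝓝 w₀, τ w = (S (‖Θ w‖ ^ 2) : ℂ) := by
    filter_upwards [hΘt.eventually hτS, hV.mem_nhds hwV] with w hw hwV'
    rwa [hinv.2 hwV'] at hw
  rcases hS.eventually_eq_or_eventually_ne (analyticAt_const (v := S 0)) with hc | hc
  · -- if `S` were constant, `τ` would be constant on `Ms`, and so would `T`
    have h1 : τ =ᶠ[𝓝 w₀] fun _ => ((S 0 : ℝ) : ℂ) := by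
      have ht : Tendsto (fun w => ‖Θ w‖ ^ 2) (𝓝 w₀) (𝓝 0) := by
        simpa using (hΘt.norm).pow 2
      filter_upwards [hτΘ, ht.eventually hc] with w hw hw2
      rw [hw, hw2]
    have h2 := hτ.eqOn_of_preconnected_of_eventuallyEq analyticOnNhd_const hMc (hVM hwV) h1
    have h3 : ∀ᶠ y in 𝓝[≥] (0 : ℝ), T y = S 0 := by
      refine eventually_nhdsGE_of_norm_sq hn ?_
      filter_upwards [hτT, hMs.mem_nhds h0] with w hw hwM
      exact ofReal_injective (hw.symm.trans (h2 hwM))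
    have h4 : ∀ᶠ y in 𝓝 (0 : ℝ), T y = S 0 := by
      refine (hT.frequently_eq_iff_eventually_eq analyticAt_const).1 ?_
      exact (h3.filter_mono (nhdsWithin_mono _ Ioi_subset_Ici_self)).frequently.filter_mono
        (nhdsWithin_mono _ fun x hx => ne_of_gt hx)
    exact hTc (h4.mono fun y hy => hy.trans h4.self_of_nhds.symm)
  · have hrot : AnalyticOnNhd ℝ (fun w => fderiv ℝ τ w (I • w)) Ms := by
      intro w hw
      have h1 : AnalyticAt ℝ (fun w : Cn n => I • w) w :=
        ((I • ContinuousLinearMap.id ℂ (Cn n)).restrictScalars ℝ).analyticAt w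
      exact ((ContinuousLinearMap.id ℝ (Cn n →L[ℝ] ℂ)).analyticAt_bilinear
        (fderiv ℝ τ w, I • w)).comp₂ (hτ w hw).fderiv h1
    have hrot0 : (fun w => fderiv ℝ τ w (I • w)) =ᶠ[𝓝 0] fun _ => 0 := by
      have hTn : ∀ᶠ w : Cn n in 𝓝 0, AnalyticAt ℝ T (‖w‖ ^ 2) :=
        eventually_analyticAt_norm_sq (by simpa using hT)
      filter_upwards [hτT.eventually_nhds, hTn] with w hw hTw
      have h1 : HasFDerivAt (fun w : Cn n => ((T (‖w‖ ^ 2) : ℝ) : ℂ)) _ w :=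
        (ofRealCLM.hasFDerivAt).comp w (hasFDerivAt_comp_norm_sq hTw.differentiableAt)
      rw [EventuallyEq.fderiv_eq hw, h1.fderiv]
      simp [real_inner_eq_re, ← ofReal_pow]
    have hrotM := hrot.eqOn_of_preconnected_of_eventuallyEq analyticOnNhd_const hMc h0 hrot0
    set γ : ℝ → Cn n := fun t => cexp ((1 * t : ℝ) * I) • w₀ with hγ
    have hγ0 : γ 0 = w₀ := by simp [hγ]
    have hγd := fun t => hasDerivAt_exp_mul_I_smul 1 w₀ t
    have hγt : Tendsto γ (𝓝 0) (𝓝 w₀) := by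
      have : Tendsto γ (𝓝 0) (𝓝 (γ 0)) := (hγd 0).continuousAt.tendsto
      rwa [hγ0] at this
    obtain ⟨ε, hε, hb⟩ := Metric.eventually_nhds_iff_ball.1
      (hγt.eventually (hMs.mem_nhds (hVM hwV)))
    have hd : ∀ t ∈ Metric.ball (0 : ℝ) ε, HasDerivAt (fun t => τ (γ t)) 0 t := by
      intro t ht
      have h1 := ((hτ _ (hb t ht)).differentiableAt.hasFDerivAt).comp_hasDerivAt t (hγd t)
      refine h1.congr_deriv ?_
      rw [one_smul]
      exact hrotM (hb t ht)
    have hconst : ∀ t ∈ Metric.ball (0 : ℝ) ε, τ (γ t) = τ w₀ := by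
      intro t ht
      have := Metric.isOpen_ball.is_const_of_deriv_eq_zero (convex_ball (0 : ℝ) ε).isPreconnected
        (fun y hy => (hd y hy).differentiableAt.differentiableWithinAt)
        (fun y hy => (hd y hy).deriv) ht (Metric.mem_ball_self hε)
      rwa [hγ0] at this
    have hzt : Tendsto (fun t => ‖Θ (γ t)‖ ^ 2) (𝓝 0) (𝓝 0) := by
      simpa using ((hΘt.comp hγt).norm).pow 2
    have hfix : ∀ᶠ t in 𝓝 (0 : ℝ), γ t = w₀ := by
      filter_upwards [hzt.eventually (eventually_nhdsWithin_iff.1 hc), hγt.eventually hτΘ,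
        hγt.eventually (hV.mem_nhds hwV), Metric.ball_mem_nhds 0 hε] with t h1 h2 h3 h4
      have h5 : S (‖Θ (γ t)‖ ^ 2) = S 0 := by
        have h6 := hτΘ.self_of_nhds
        rw [hΘ0] at h6
        have := (h2.symm.trans (hconst t h4)).trans h6
        simpa using ofReal_injective this
      have h7 : Θ (γ t) = 0 := by
        by_contra hne
        exact h1 (by simpa using hne) h5
      rw [← hinv.2 h3, h7]
    have hder : HasDerivAt γ 0 0 := (hasDerivAt_const (0 : ℝ) w₀).congr_of_eventuallyEq hfix
    have := (hγd 0).unique hder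
    simp [hw0] at this

/-! ### Local normal form and circle actions -/

theorem radialForm_I_smul_self_left {n : ℕ} (a b : ℝ) (z w : Cn n) :
    radialForm a b z (I • z) w = -((a + b * ‖z‖ ^ 2) * (inner ℂ z w).re) := by
  rw [radialForm, inner_I_smul_left, inner_I_smul_right, inner_self_eq_norm_sq_ofReal]
  generalize inner ℂ z w = c, ‖z‖ ^ 2 = x
  simp
  ring

theorem radialForm_self_left {n : ℕ} (a b : ℝ) (z w : Cn n) :
    radialForm a b z z w = (a + b * ‖z‖ ^ 2) * (inner ℂ z w).im := by
  rw [radialForm, inner_self_eq_norm_sq_ofReal, conj_ofReal, im_ofReal_mul]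
  ring

/-- At `z ≠ 0`, the derivative of a function of `|z|` in a direction `v` depends only on the component
of `v` along `z`. -/
theorem fderiv_apply_of_radial {n : ℕ} {F : Type*} [NormedAddCommGroup F] [NormedSpace ℝ F]
    {N : Cn n → F} {z : Cn n} {s : Set (Cn n)} (hs : s ∈ 𝓝 z) (hz : z ≠ 0)
    (hN : DifferentiableAt ℝ N z) (hr : ∀ w ∈ s, ∀ w' ∈ s, ‖w‖ = ‖w'‖ → N w = N w') (v : Cn n) :
    fderiv ℝ N z v = ((inner ℂ z v).re / ‖z‖ ^ 2) • fderiv ℝ N z z := by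
  have hz' : ‖z‖ ≠ 0 := norm_ne_zero_iff.2 hz
  set ρ : Cn n → Cn n := fun w => (Real.sqrt (‖w‖ ^ 2) / ‖z‖) • z with hρ
  have hρz : ρ z = z := by
    simp [hρ, Real.sqrt_sq, hz']
  have h1 := (hasFDerivAt_comp_norm_sq (φ := fun x => Real.sqrt x / ‖z‖) (z := z)
    ((Real.hasDerivAt_sqrt (by positivity)).differentiableAt.div_const _)).smul_const z
  have hder : deriv (fun x => Real.sqrt x / ‖z‖) (‖z‖ ^ 2) = 1 / (2 * ‖z‖ ^ 2) := by
    rw [((Real.hasDerivAt_sqrt (by positivity)).div_const _).deriv, Real.sqrt_sq (norm_nonneg _)]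
    field_simp
  have h2 : HasFDerivAt ρ _ z := h1
  have h3 : N =ᶠ[𝓝 z] N ∘ ρ := by
    have hc : Tendsto ρ (𝓝 z) (𝓝 z) := by
      have := h2.continuousAt.tendsto
      rwa [hρz] at this
    filter_upwards [hs, hc.eventually hs] with w hw hw2
    refine hr w hw _ hw2 ?_
    simp only [hρ]
    rw [Real.sqrt_sq (norm_nonneg _), norm_smul, norm_div, norm_norm, norm_norm,
      div_mul_cancel₀ _ hz']
  have h4 : HasFDerivAt (N ∘ ρ) _ z := HasFDerivAt.comp z (by rw [hρz]; exact hN.hasFDerivAt) h2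
  rw [h3.fderiv_eq, h4.fderiv]
  simp only [ContinuousLinearMap.comp_apply, ContinuousLinearMap.smulRight_apply, map_smul,
    smul_apply, innerSL_apply_apply, hder, real_inner_eq_re, smul_smul]
  rw [inner_self_eq_norm_sq_ofReal, ofReal_re]
  congr 1
  simp only [smul_eq_mul]
  field_simp

/-- The local normal form of a `lam`-symplectic duality for the potential `f(|z|²)` and its dual
`-f(-|z|²)`: a smooth injective map on the ball of radius `ε` that fixes the origin, maps spheres
into spheres, and relates the flat form to the two Kähler forms. The ball is small enough for `f'`
and `(x f')'` to be positive, and for `f''(-|Ψ(z)|²)` to vanish at most for `z = 0`. -/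
structure IsRadialDuality {n : ℕ} (lam : ℝ) (f : ℝ → ℝ) (ε : ℝ) (Ψ : Cn n → Cn n) : Prop where
  dim_ne_zero : n ≠ 0
  lam_pos : 0 < lam
  radius_pos : 0 < ε
  contDiffOn : ContDiffOn ℝ ∞ Ψ (Metric.ball 0 ε)
  injOn : InjOn Ψ (Metric.ball 0 ε)
  map_zero : Ψ 0 = 0
  norm_map_eq : ∀ z ∈ Metric.ball (0 : Cn n) ε, ∀ w ∈ Metric.ball (0 : Cn n) ε,
    ‖z‖ = ‖w‖ → ‖Ψ z‖ = ‖Ψ w‖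
  pullback_flat : ∀ z ∈ Metric.ball (0 : Cn n) ε, ∀ v w : Cn n,
    (inner ℂ (fderiv ℝ Ψ z v) (fderiv ℝ Ψ z w)).im
      = lam * radialForm (deriv f (‖z‖ ^ 2)) (deriv (deriv f) (‖z‖ ^ 2)) z v w
  pullback_dual : ∀ z ∈ Metric.ball (0 : Cn n) ε, ∀ v w : Cn n,
    lam * radialForm (deriv f (-‖Ψ z‖ ^ 2)) (-deriv (deriv f) (-‖Ψ z‖ ^ 2)) (Ψ z)
      (fderiv ℝ Ψ z v) (fderiv ℝ Ψ z w) = (inner ℂ v w).im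
  analyticAt : ∀ z ∈ Metric.ball (0 : Cn n) ε, AnalyticAt ℝ f (‖z‖ ^ 2)
  deriv_pos : ∀ z ∈ Metric.ball (0 : Cn n) ε, 0 < deriv f (‖z‖ ^ 2)
  deriv_add_pos : ∀ z ∈ Metric.ball (0 : Cn n) ε,
    0 < deriv f (‖z‖ ^ 2) + deriv (deriv f) (‖z‖ ^ 2) * ‖z‖ ^ 2
  deriv_deriv_ne_zero : ∀ z ∈ Metric.ball (0 : Cn n) ε, z ≠ 0 →
    deriv (deriv f) (-‖Ψ z‖ ^ 2) ≠ 0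

namespace IsRadialDuality

variable {n : ℕ} {lam : ℝ} {f : ℝ → ℝ} {ε : ℝ} {Ψ : Cn n → Cn n}

theorem mono (H : IsRadialDuality lam f ε Ψ) {δ : ℝ} (hδ : 0 < δ) (h : δ ≤ ε) :
    IsRadialDuality lam f δ Ψ := by
  have hs := Metric.ball_subset_ball (x := (0 : Cn n)) h
  exact ⟨H.dim_ne_zero, H.lam_pos, hδ, H.contDiffOn.mono hs, H.injOn.mono hs, H.map_zero,
    fun z hz w hw => H.norm_map_eq z (hs hz) w (hs hw), fun z hz => H.pullback_flat z (hs hz),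
    fun z hz => H.pullback_dual z (hs hz), fun z hz => H.analyticAt z (hs hz),
    fun z hz => H.deriv_pos z (hs hz), fun z hz => H.deriv_add_pos z (hs hz),
    fun z hz => H.deriv_deriv_ne_zero z (hs hz)⟩

theorem zero_mem (H : IsRadialDuality lam f ε Ψ) : (0 : Cn n) ∈ Metric.ball (0 : Cn n) ε :=
  Metric.mem_ball_self H.radius_pos

theorem smul_mem {z : Cn n} (hz : z ∈ Metric.ball (0 : Cn n) ε) (t : ℝ) :
    cexp (t * I) • z ∈ Metric.ball (0 : Cn n) ε := by
  rw [mem_ball_zero_iff, norm_exp_ofReal_mul_I_smul]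
  exact mem_ball_zero_iff.1 hz

theorem differentiableAt (H : IsRadialDuality lam f ε Ψ) {z : Cn n}
    (hz : z ∈ Metric.ball (0 : Cn n) ε) : DifferentiableAt ℝ Ψ z :=
  (H.contDiffOn.contDiffAt (Metric.isOpen_ball.mem_nhds hz)).differentiableAt (by simp)

theorem hasFDerivAt (H : IsRadialDuality lam f ε Ψ) {z : Cn n}
    (hz : z ∈ Metric.ball (0 : Cn n) ε) : HasFDerivAt Ψ (fderiv ℝ Ψ z) z :=
  (H.differentiableAt hz).hasFDerivAt

theorem fderiv_injective (H : IsRadialDuality lam f ε Ψ) {z : Cn n}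
    (hz : z ∈ Metric.ball (0 : Cn n) ε) : Function.Injective (fderiv ℝ Ψ z) := by
  refine (injective_iff_map_eq_zero _).2 fun v hv => ?_
  refine eq_of_forall_im_inner_eq fun w => ?_
  rw [← H.pullback_dual z hz v w, hv, radialForm]
  simp

theorem eq_of_forall_im_inner_fderiv_eq (H : IsRadialDuality lam f ε Ψ) {z : Cn n}
    (hz : z ∈ Metric.ball (0 : Cn n) ε) {u v : Cn n}
    (h : ∀ w, (inner ℂ u (fderiv ℝ Ψ z w)).im = (inner ℂ v (fderiv ℝ Ψ z w)).im) : u = v := by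
  refine eq_of_forall_im_inner_eq fun w => ?_
  obtain ⟨w, rfl⟩ := (LinearMap.injective_iff_surjective
    (f := (fderiv ℝ Ψ z : Cn n →ₗ[ℝ] Cn n))).1 (H.fderiv_injective hz) w
  exact h w

theorem apply_ne_zero (H : IsRadialDuality lam f ε Ψ) {z : Cn n}
    (hz : z ∈ Metric.ball (0 : Cn n) ε) (hz0 : z ≠ 0) : Ψ z ≠ 0 := fun h =>
  hz0 (H.injOn hz H.zero_mem (h.trans H.map_zero.symm))

theorem fderiv_norm_sq_apply (H : IsRadialDuality lam f ε Ψ) {z : Cn n}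
    (hz : z ∈ Metric.ball (0 : Cn n) ε) (v : Cn n) :
    fderiv ℝ (fun w => ‖Ψ w‖ ^ 2) z v = 2 * (inner ℂ (Ψ z) (fderiv ℝ Ψ z v)).re := by
  rw [(H.hasFDerivAt hz).norm_sq.fderiv]
  simp [← real_inner_eq_re]

theorem differentiableAt_norm_sq (H : IsRadialDuality lam f ε Ψ) {z : Cn n}
    (hz : z ∈ Metric.ball (0 : Cn n) ε) : DifferentiableAt ℝ (fun w => ‖Ψ w‖ ^ 2) z :=
  (H.hasFDerivAt hz).norm_sq.differentiableAt

theorem re_inner_fderiv_eq (H : IsRadialDuality lam f ε Ψ) {z : Cn n}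
    (hz : z ∈ Metric.ball (0 : Cn n) ε) (hz0 : z ≠ 0) (v : Cn n) :
    (inner ℂ (Ψ z) (fderiv ℝ Ψ z v)).re
      = (inner ℂ (Ψ z) (fderiv ℝ Ψ z z)).re / ‖z‖ ^ 2 * (inner ℂ z v).re := by
  have h := fderiv_apply_of_radial (Metric.isOpen_ball.mem_nhds hz) hz0
    (H.differentiableAt_norm_sq hz)
    (fun w hw w' hw' hww => by rw [H.norm_map_eq w hw w' hw' hww]) v
  rw [H.fderiv_norm_sq_apply hz, H.fderiv_norm_sq_apply hz, smul_eq_mul] at h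
  linear_combination h / 2

/-- Hamiltonian vector fields: `i w` generates `|w|² / 2` for the flat form, so its pull-back
generates a radial function for `lam ω`, and is a radial multiple of `i z`. -/
theorem smul_fderiv_I_smul (H : IsRadialDuality lam f ε Ψ) {z : Cn n}
    (hz : z ∈ Metric.ball (0 : Cn n) ε) (hz0 : z ≠ 0) :
    ((inner ℂ (Ψ z) (fderiv ℝ Ψ z z)).re / ‖z‖ ^ 2) • fderiv ℝ Ψ z (I • z)
      = (lam * (deriv f (‖z‖ ^ 2) + deriv (deriv f) (‖z‖ ^ 2) * ‖z‖ ^ 2)) • (I • Ψ z) := by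
  refine H.eq_of_forall_im_inner_fderiv_eq hz fun w => ?_
  rw [← Complex.coe_smul, ← Complex.coe_smul, inner_smul_left, inner_smul_left, conj_ofReal,
    conj_ofReal, im_ofReal_mul, im_ofReal_mul, H.pullback_flat z hz, radialForm_I_smul_self_left,
    inner_I_smul_left, neg_mul, neg_im, I_mul_im, H.re_inner_fderiv_eq hz hz0 w]
  ring

theorem re_inner_fderiv_rotate (H : IsRadialDuality lam f ε Ψ) {z : Cn n}
    (hz : z ∈ Metric.ball (0 : Cn n) ε) (t : ℝ) :
    (inner ℂ (Ψ (cexp (t * I) • z)) (fderiv ℝ Ψ (cexp (t * I) • z) (cexp (t * I) • z))).re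
      = (inner ℂ (Ψ z) (fderiv ℝ Ψ z z)).re := by
  have key : ∀ u ∈ Metric.ball (0 : Cn n) ε, HasDerivAt (fun s : ℝ => ‖Ψ (s • u)‖ ^ 2)
      (2 * (inner ℂ (Ψ u) (fderiv ℝ Ψ u u)).re) 1 := by
    intro u hu
    have h1 : HasDerivAt (fun s : ℝ => s • u) u 1 := by
      simpa using (hasDerivAt_id (1 : ℝ)).smul_const u
    have h2 := HasFDerivAt.comp_hasDerivAt (f := fun s : ℝ => s • u)
      (l := fun w => ‖Ψ w‖ ^ 2) 1 (by
        rw [one_smul]; exact (H.differentiableAt_norm_sq hu).hasFDerivAt) h1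
    rwa [H.fderiv_norm_sq_apply hu] at h2
  have hu := smul_mem hz t
  have hev : (fun s : ℝ => ‖Ψ (s • (cexp (t * I) • z))‖ ^ 2) =ᶠ[𝓝 1]
      fun s : ℝ => ‖Ψ (s • z)‖ ^ 2 := by
    have hc : ∀ u ∈ Metric.ball (0 : Cn n) ε, ∀ᶠ s : ℝ in 𝓝 1,
        s • u ∈ Metric.ball (0 : Cn n) ε := fun u hu =>
      ((by fun_prop : Continuous fun s : ℝ => s • u).tendsto 1).eventually
        (Metric.isOpen_ball.mem_nhds (by simpa using hu))
    filter_upwards [hc _ hu, hc _ hz] with s h1 h2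
    rw [H.norm_map_eq _ h1 _ h2]
    rw [norm_smul s, norm_smul s, norm_exp_ofReal_mul_I_smul]
  have := ((key _ hu).congr_of_eventuallyEq hev.symm).unique (key _ hz)
  linarith

/-- The real `c` with `dΨ(c i z) = i Ψ(z)` for a duality `Ψ` in local normal form and `z ≠ 0`: the
radial derivative of `|Ψ|²` divided by that of `lam |z|² f'(|z|²)`. Its value at `z = 0` is a junk
value. -/
noncomputable def rotationCoeff (lam : ℝ) (f : ℝ → ℝ) (Ψ : Cn n → Cn n) (z : Cn n) : ℝ :=
  (inner ℂ (Ψ z) (fderiv ℝ Ψ z z)).re / ‖z‖ ^ 2 /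
    (lam * (deriv f (‖z‖ ^ 2) + deriv (deriv f) (‖z‖ ^ 2) * ‖z‖ ^ 2))

theorem rotationCoeff_smul (H : IsRadialDuality lam f ε Ψ) {z : Cn n}
    (hz : z ∈ Metric.ball (0 : Cn n) ε) (hz0 : z ≠ 0) :
    rotationCoeff lam f Ψ z • fderiv ℝ Ψ z (I • z) = I • Ψ z := by
  have h := (mul_pos H.lam_pos (H.deriv_add_pos z hz)).ne'
  rw [rotationCoeff, div_eq_inv_mul, mul_smul, H.smul_fderiv_I_smul hz hz0, smul_smul,
    inv_mul_cancel₀ h, one_smul]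

/-- The map `Ψ` intertwines the rotation of speed `rotationCoeff` with that of speed `1`. -/
theorem apply_rotate (H : IsRadialDuality lam f ε Ψ) {z : Cn n}
    (hz : z ∈ Metric.ball (0 : Cn n) ε) (hz0 : z ≠ 0) (t : ℝ) :
    Ψ (cexp ((rotationCoeff lam f Ψ z * t : ℝ) * I) • z) = cexp (t * I) • Ψ z := by
  set c := rotationCoeff lam f Ψ z with hc
  set γ : ℝ → Cn n := fun t => cexp ((c * t : ℝ) * I) • z
  have hγ := fun t => hasDerivAt_exp_mul_I_smul c z t
  have hγn : ∀ t, ‖γ t‖ = ‖z‖ := fun t => norm_exp_ofReal_mul_I_smul _ z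
  have hγb : ∀ t, γ t ∈ Metric.ball (0 : Cn n) ε := fun t => smul_mem hz _
  have hγ0 : ∀ t, γ t ≠ 0 := fun t => by
    rw [← norm_ne_zero_iff, hγn]; exact norm_ne_zero_iff.2 hz0
  have hcγ : ∀ t, rotationCoeff lam f Ψ (γ t) = c := fun t => by
    rw [hc, rotationCoeff, rotationCoeff, hγn, H.re_inner_fderiv_rotate hz]
  have h1 : ∀ t, HasDerivAt (fun t : ℝ => Ψ (γ t)) (I • Ψ (γ t)) t := by
    intro t
    refine ((H.hasFDerivAt (hγb t)).comp_hasDerivAt t (hγ t)).congr_deriv ?_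
    rw [map_smul, ← H.rotationCoeff_smul (hγb t) (hγ0 t), hcγ]
  have h2 : ∀ t, HasDerivAt (fun t : ℝ => cexp ((-1 * t : ℝ) * I) • Ψ (γ t)) 0 t := by
    intro t
    have h3 : HasDerivAt (fun t : ℝ => cexp ((-1 * t : ℝ) * I))
        (-I * cexp ((-1 * t : ℝ) * I)) t := by
      have h4 : HasDerivAt (fun t : ℝ => ((-1 * t : ℝ) : ℂ)) (-1 : ℂ) t := by
        simpa using ((hasDerivAt_id t).const_mul (-1)).ofReal_comp
      refine ((h4.mul_const I).cexp).congr_deriv ?_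
      ring
    refine (h3.smul (h1 t)).congr_deriv ?_
    rw [smul_smul, ← add_smul]
    convert zero_smul ℂ _ using 2
    ring
  have h5 := is_const_of_deriv_eq_zero (fun t => (h2 t).differentiableAt)
    (fun t => (h2 t).deriv) t 0
  have h6 : γ 0 = z := by simp [γ]
  simp only [h6, mul_zero, ofReal_zero, zero_mul, Complex.exp_zero, one_smul] at h5
  rw [← h5, smul_smul, ← Complex.exp_add]
  simp [γ]

theorem exists_int_eq_rotationCoeff (H : IsRadialDuality lam f ε Ψ) {z : Cn n}
    (hz : z ∈ Metric.ball (0 : Cn n) ε) (hz0 : z ≠ 0) :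
    ∃ k : ℤ, rotationCoeff lam f Ψ z = k := by
  have h1 := H.apply_rotate hz hz0 (2 * Real.pi)
  have h2 : cexp ((2 * Real.pi : ℝ) * I) = 1 := by
    push_cast; exact Complex.exp_two_pi_mul_I
  rw [h2, one_smul] at h1
  have h3 := H.injOn (smul_mem hz _) hz h1
  have h4 : (cexp ((rotationCoeff lam f Ψ z * (2 * Real.pi) : ℝ) * I) - 1) • z = 0 := by
    rw [sub_smul, h3, one_smul, sub_self]
  obtain ⟨k, hk⟩ := Complex.exp_eq_one_iff.1 (sub_eq_zero.1 ((smul_eq_zero.1 h4).resolve_right hz0))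
  refine ⟨k, ?_⟩
  have h5 : ((rotationCoeff lam f Ψ z * (2 * Real.pi) : ℝ) : ℂ) = ((k * (2 * Real.pi) : ℝ) : ℂ) := by
    refine mul_right_cancel₀ I_ne_zero ?_
    rw [hk]; push_cast; ring
  exact mul_right_cancel₀ (by positivity) (ofReal_injective h5)

end IsRadialDuality

/-! ### Equivariance and the functional equation -/

namespace IsRadialDuality

variable {n : ℕ} {lam : ℝ} {f : ℝ → ℝ} {ε : ℝ} {Ψ : Cn n → Cn n}

theorem tendsto_inv_smul_apply (H : IsRadialDuality lam f ε Ψ) (v : Cn n) :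
    Tendsto (fun r : ℝ => r⁻¹ • Ψ (r • v)) (𝓝[≠] 0) (𝓝 (fderiv ℝ Ψ 0 v)) := by
  have h1 : HasDerivAt (fun s : ℝ => s • v) v 0 := by
    simpa using (hasDerivAt_id (0 : ℝ)).smul_const v
  have h2 : HasDerivAt (fun r : ℝ => Ψ (r • v)) (fderiv ℝ Ψ 0 v) 0 :=
    HasFDerivAt.comp_hasDerivAt (f := fun s : ℝ => s • v) (l := Ψ) 0 (by
      rw [zero_smul]; exact H.hasFDerivAt H.zero_mem) h1
  refine (hasDerivAt_iff_tendsto_slope.1 h2).congr fun r => ?_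
  simp [slope_def_module, H.map_zero]

theorem eventually_smul_mem (H : IsRadialDuality lam f ε Ψ) (v : Cn n) :
    ∀ᶠ r : ℝ in 𝓝[≠] 0, r • v ∈ Metric.ball (0 : Cn n) ε :=
  (((by fun_prop : Continuous fun r : ℝ => r • v).tendsto 0).eventually
    (Metric.isOpen_ball.mem_nhds (by simpa using H.radius_pos))).filter_mono nhdsWithin_le_nhds

theorem norm_fderiv_zero_eq (H : IsRadialDuality lam f ε Ψ) {v w : Cn n} (h : ‖v‖ = ‖w‖) :
    ‖fderiv ℝ Ψ 0 v‖ = ‖fderiv ℝ Ψ 0 w‖ := by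
  refine tendsto_nhds_unique ((H.tendsto_inv_smul_apply v).norm.congr' ?_)
    (H.tendsto_inv_smul_apply w).norm
  filter_upwards [H.eventually_smul_mem v, H.eventually_smul_mem w] with r h1 h2
  rw [norm_smul, norm_smul, H.norm_map_eq _ h1 _ h2 (by rw [norm_smul, norm_smul, h])]

/-- The derivative at the origin is conformal. -/
theorem exists_norm_fderiv_zero (H : IsRadialDuality lam f ε Ψ) :
    ∃ k > 0, ∀ v, ‖fderiv ℝ Ψ 0 v‖ = k * ‖v‖ := by
  obtain ⟨e, he⟩ := exists_norm_eq_one H.dim_ne_zero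
  refine ⟨‖fderiv ℝ Ψ 0 e‖, norm_pos_iff.2 fun h => ?_, fun v => ?_⟩
  · have : e = 0 := H.fderiv_injective H.zero_mem (h.trans (_root_.map_zero _).symm)
    rw [this, norm_zero] at he
    exact zero_ne_one he
  · rw [H.norm_fderiv_zero_eq (w := ‖v‖ • e) (by rw [norm_smul, he, norm_norm, mul_one]),
      map_smul, norm_smul, norm_norm, mul_comm]

theorem eventually_fderiv_close (H : IsRadialDuality lam f ε Ψ) {η : ℝ} (hη : 0 < η) :
    ∀ᶠ z in 𝓝 (0 : Cn n), ‖Ψ z - fderiv ℝ Ψ 0 z‖ ≤ η * ‖z‖ ∧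
      ∀ v, ‖fderiv ℝ Ψ z v - fderiv ℝ Ψ 0 v‖ ≤ η * ‖v‖ := by
  have h1 := (H.hasFDerivAt H.zero_mem).isLittleO.def hη
  have hc : ContinuousAt (fderiv ℝ Ψ) 0 :=
    (H.contDiffOn.contDiffAt (Metric.isOpen_ball.mem_nhds H.zero_mem)).continuousAt_fderiv
      (by simp)
  filter_upwards [h1, Metric.continuousAt_iff'.1 hc η hη] with z hz hz2
  refine ⟨by simpa [H.map_zero] using hz, fun v => ?_⟩
  rw [dist_eq_norm] at hz2
  calc _ = ‖(fderiv ℝ Ψ z - fderiv ℝ Ψ 0) v‖ := by simp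
    _ ≤ _ := ContinuousLinearMap.le_of_opNorm_le _ hz2.le v

/-- Near the origin `Ψ` intertwines the two circle actions: their speeds have an integer ratio,
which is positive and close to one because `Ψ` is close to its conformal linear part. -/
theorem exists_fderiv_I_smul (H : IsRadialDuality lam f ε Ψ) :
    ∃ δ > 0, δ ≤ ε ∧ ∀ z ∈ Metric.ball (0 : Cn n) δ,
      fderiv ℝ Ψ z (I • z) = I • Ψ z := by
  obtain ⟨k, hk, hL⟩ := H.exists_norm_fderiv_zero
  obtain ⟨δ, hδ, hb⟩ := Metric.eventually_nhds_iff_ball.1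
    (H.eventually_fderiv_close (by positivity : 0 < k / 4))
  refine ⟨min δ ε, lt_min hδ H.radius_pos, min_le_right _ _, fun z hz => ?_⟩
  have hzε := Metric.ball_subset_ball (min_le_right δ ε) hz
  obtain ⟨h1, h2⟩ := hb z (Metric.ball_subset_ball (min_le_left δ ε) hz)
  by_cases hz0 : z = 0
  · rw [hz0, smul_zero, H.map_zero, smul_zero, _root_.map_zero]
  have hx : 0 < ‖z‖ := norm_pos_iff.2 hz0
  have hI : ‖I • z‖ = ‖z‖ := by rw [norm_smul, norm_I, one_mul]
  set u := fderiv ℝ Ψ 0 z with hu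
  have hun : ‖u‖ = k * ‖z‖ := hL z
  have e1 := abs_le.1 ((abs_norm_sub_norm_le (Ψ z) u).trans h1)
  have e2 := abs_le.1 ((abs_norm_sub_norm_le (fderiv ℝ Ψ z (I • z)) _).trans (h2 (I • z)))
  rw [hL, hI] at e2
  rw [hun] at e1
  have hpos : 0 < (inner ℂ (Ψ z) (fderiv ℝ Ψ z z)).re := by
    have h3 := h2 z
    rw [← hu] at h3
    have e3 : inner ℝ (Ψ z) (fderiv ℝ Ψ z z) = ‖u‖ ^ 2 + inner ℝ u (fderiv ℝ Ψ z z - u)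
        + inner ℝ (Ψ z - u) (fderiv ℝ Ψ z z) := by
      rw [inner_sub_right, inner_sub_left, real_inner_self_eq_norm_sq]; ring
    have e4 := (abs_le.1 (abs_real_inner_le_norm u (fderiv ℝ Ψ z z - u))).1
    have e5 := (abs_le.1 (abs_real_inner_le_norm (Ψ z - u) (fderiv ℝ Ψ z z))).1
    have e6 : ‖fderiv ℝ Ψ z z‖ ≤ 5 / 4 * (k * ‖z‖) := by
      have := abs_le.1 ((abs_norm_sub_norm_le (fderiv ℝ Ψ z z) u).trans h3)
      rw [hun] at this
      linarith
    have e7 : ‖u‖ * ‖fderiv ℝ Ψ z z - u‖ ≤ (k * ‖z‖) * (k / 4 * ‖z‖) :=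
      mul_le_mul hun.le h3 (norm_nonneg _) (by positivity)
    have e8 : ‖Ψ z - u‖ * ‖fderiv ℝ Ψ z z‖ ≤ (k / 4 * ‖z‖) * (5 / 4 * (k * ‖z‖)) :=
      mul_le_mul h1 e6 (norm_nonneg _) (by positivity)
    have e9 : 0 < (k * ‖z‖) ^ 2 := by positivity
    rw [← real_inner_eq_re, e3, hun]
    nlinarith
  have hcpos : 0 < rotationCoeff lam f Ψ z :=
    div_pos (div_pos hpos (by positivity)) (mul_pos H.lam_pos (H.deriv_add_pos z hzε))
  obtain ⟨m, hm⟩ := H.exists_int_eq_rotationCoeff hzε hz0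
  have hrot := H.rotationCoeff_smul hzε hz0
  have hn : rotationCoeff lam f Ψ z * ‖fderiv ℝ Ψ z (I • z)‖ = ‖Ψ z‖ := by
    have := congrArg norm hrot
    rwa [norm_smul, norm_smul, norm_I, one_mul, Real.norm_eq_abs, abs_of_pos hcpos] at this
  have hlt : rotationCoeff lam f Ψ z < 2 := by
    by_contra! h
    have hkz : 0 < k * ‖z‖ := by positivity
    nlinarith [norm_nonneg (fderiv ℝ Ψ z (I • z))]
  rw [hm] at hcpos hlt
  have hm1 : m = 1 := by
    have h3 : 0 < m := by exact_mod_cast hcpos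
    have h4 : m < 2 := by exact_mod_cast hlt
    omega
  rwa [hm, hm1, Int.cast_one, one_smul] at hrot

theorem re_inner_fderiv_of_equivariant (H : IsRadialDuality lam f ε Ψ)
    (hI : ∀ z ∈ Metric.ball (0 : Cn n) ε, fderiv ℝ Ψ z (I • z) = I • Ψ z)
    {z : Cn n} (hz : z ∈ Metric.ball (0 : Cn n) ε) (v : Cn n) :
    (inner ℂ (Ψ z) (fderiv ℝ Ψ z v)).re
      = lam * (deriv f (‖z‖ ^ 2) + deriv (deriv f) (‖z‖ ^ 2) * ‖z‖ ^ 2) * (inner ℂ z v).re := by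
  have h1 : (inner ℂ (fderiv ℝ Ψ z (I • z)) (fderiv ℝ Ψ z v)).im
      = -(inner ℂ (Ψ z) (fderiv ℝ Ψ z v)).re := by
    rw [hI z hz, inner_I_smul_left, neg_mul, neg_im, I_mul_im]
  rw [H.pullback_flat z hz, radialForm_I_smul_self_left] at h1
  linear_combination h1

theorem norm_sq_apply_of_equivariant (H : IsRadialDuality lam f ε Ψ)
    (hI : ∀ z ∈ Metric.ball (0 : Cn n) ε, fderiv ℝ Ψ z (I • z) = I • Ψ z)
    {z : Cn n} (hz : z ∈ Metric.ball (0 : Cn n) ε) :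
    ‖Ψ z‖ ^ 2 = lam * (‖z‖ ^ 2 * deriv f (‖z‖ ^ 2)) := by
  have hd : ∀ w ∈ Metric.ball (0 : Cn n) ε, HasFDerivAt
      (fun w : Cn n => ‖Ψ w‖ ^ 2 - lam * (‖w‖ ^ 2 * deriv f (‖w‖ ^ 2))) (0 : Cn n →L[ℝ] ℝ) w := by
    intro w hw
    have h1 : HasDerivAt (fun x => lam * (x * deriv f x)) _ (‖w‖ ^ 2) :=
      ((hasDerivAt_id' _).mul
        (H.analyticAt w hw).deriv.differentiableAt.hasDerivAt).const_mul lam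
    refine ((H.differentiableAt_norm_sq hw).hasFDerivAt.sub
      (hasFDerivAt_comp_norm_sq h1.differentiableAt)).congr_fderiv ?_
    ext v
    simp only [sub_apply, smul_apply, innerSL_apply_apply, h1.deriv, real_inner_eq_re,
      H.fderiv_norm_sq_apply hw, H.re_inner_fderiv_of_equivariant hI hw, smul_eq_mul, zero_apply]
    ring
  have := Metric.isOpen_ball.is_const_of_fderiv_eq_zero (𝕜 := ℝ)
    (convex_ball (0 : Cn n) ε).isPreconnected
    (fun w hw => (hd w hw).differentiableAt.differentiableWithinAt)
    (fun w hw => (hd w hw).fderiv) hz H.zero_mem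
  simp only [H.map_zero, norm_zero] at this
  linarith

/-- The eigenvalues along the circle orbits of the two pulled back forms are inverse to each
other. -/
theorem deriv_add_mul_eq_one (H : IsRadialDuality lam f ε Ψ)
    (hI : ∀ z ∈ Metric.ball (0 : Cn n) ε, fderiv ℝ Ψ z (I • z) = I • Ψ z)
    {z : Cn n} (hz : z ∈ Metric.ball (0 : Cn n) ε) (hz0 : z ≠ 0) :
    lam ^ 2 * (deriv f (‖z‖ ^ 2) + deriv (deriv f) (‖z‖ ^ 2) * ‖z‖ ^ 2) *
      (deriv f (-‖Ψ z‖ ^ 2) + -deriv (deriv f) (-‖Ψ z‖ ^ 2) * ‖Ψ z‖ ^ 2) = 1 := by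
  have h1 := H.pullback_dual z hz (I • z) z
  rw [hI z hz, radialForm_I_smul_self_left, inner_I_smul_left, inner_self_eq_norm_sq_ofReal,
    H.re_inner_fderiv_of_equivariant hI hz, inner_self_eq_norm_sq_ofReal, ofReal_re, neg_mul I,
    neg_im, I_mul_im, ofReal_re] at h1
  have hx : ‖z‖ ^ 2 ≠ 0 := by simpa using hz0
  refine mul_right_cancel₀ hx ?_
  linear_combination -h1

theorem eventually_mul_deriv_eq_one (H : IsRadialDuality lam f ε Ψ)
    (hI : ∀ z ∈ Metric.ball (0 : Cn n) ε, fderiv ℝ Ψ z (I • z) = I • Ψ z) :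
    ∀ᶠ x in 𝓝 (0 : ℝ), lam ^ 2 * deriv f x * deriv f (-(lam * x * deriv f x)) = 1 := by
  refine _root_.eventually_mul_deriv_eq_one (by simpa using H.analyticAt 0 H.zero_mem) ?_
  have h : ∀ᶠ z : Cn n in 𝓝 0, ‖z‖ ^ 2 ≠ 0 → lam ^ 2 * (deriv f (‖z‖ ^ 2) + ‖z‖ ^ 2
      * deriv (deriv f) (‖z‖ ^ 2)) * (deriv f (-(lam * ‖z‖ ^ 2 * deriv f (‖z‖ ^ 2)))
        + -(lam * ‖z‖ ^ 2 * deriv f (‖z‖ ^ 2))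
          * deriv (deriv f) (-(lam * ‖z‖ ^ 2 * deriv f (‖z‖ ^ 2)))) = 1 := by
    filter_upwards [Metric.ball_mem_nhds 0 H.radius_pos] with z hz hx
    have h1 := H.deriv_add_mul_eq_one hI hz (by simpa using hx)
    rw [H.norm_sq_apply_of_equivariant hI hz, ← mul_assoc] at h1
    linear_combination h1
  have h2 := eventually_nhdsGE_of_norm_sq H.dim_ne_zero (p := fun x => x ≠ 0 → lam ^ 2 *
    (deriv f x + x * deriv (deriv f) x) * (deriv f (-(lam * x * deriv f x))
        + -(lam * x * deriv f x) * deriv (deriv f) (-(lam * x * deriv f x))) = 1) h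
  filter_upwards [h2.filter_mono (nhdsWithin_mono _ Ioi_subset_Ici_self), self_mem_nhdsWithin]
    with x hx hx0
  exact hx (ne_of_gt hx0)

/-- The radial field is an eigenvector: both eigenspaces through `z` and through `Ψ z` are complex
lines, as `f''` does not vanish. -/
theorem norm_sq_smul_fderiv_self (H : IsRadialDuality lam f ε Ψ)
    (hI : ∀ z ∈ Metric.ball (0 : Cn n) ε, fderiv ℝ Ψ z (I • z) = I • Ψ z)
    {z : Cn n} (hz : z ∈ Metric.ball (0 : Cn n) ε) (hz0 : z ≠ 0) :
    ((‖Ψ z‖ ^ 2 : ℝ) : ℂ) • fderiv ℝ Ψ z z = inner ℂ (Ψ z) (fderiv ℝ Ψ z z) • Ψ z := by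
  set a := deriv f (-‖Ψ z‖ ^ 2) with ha
  set b := -deriv (deriv f) (-‖Ψ z‖ ^ 2) with hb
  have hb0 : (b : ℂ) ≠ 0 := by
    exact_mod_cast neg_ne_zero.2 (H.deriv_deriv_ne_zero z hz hz0)
  set h' := deriv f (‖z‖ ^ 2) + deriv (deriv f) (‖z‖ ^ 2) * ‖z‖ ^ 2 with hh'
  have h1 : lam ^ 2 * h' * (a + b * ‖Ψ z‖ ^ 2) = 1 := H.deriv_add_mul_eq_one hI hz hz0
  set u := fderiv ℝ Ψ z z with hu
  have h2 : ((lam ^ 2 * h' : ℝ) : ℂ) • ((a : ℂ) • u + ((b : ℂ) * inner ℂ (Ψ z) u) • Ψ z) = u := by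
    refine H.eq_of_forall_im_inner_fderiv_eq hz fun w => ?_
    rw [inner_smul_left, conj_ofReal, im_ofReal_mul, ← radialForm_eq_im_inner]
    have e1 := H.pullback_dual z hz z w
    have e2 := H.pullback_flat z hz z w
    rw [radialForm_self_left] at e2
    rw [e2]
    linear_combination lam * h' * e1
  have h3 : ((lam ^ 2 * h' : ℝ) : ℂ) ≠ 0 := by
    exact_mod_cast left_ne_zero_of_mul (h1.trans_ne one_ne_zero)
  have h4 : ((lam ^ 2 * h' : ℝ) : ℂ) • ((b : ℂ) • (inner ℂ (Ψ z) u • Ψ z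
      - ((‖Ψ z‖ ^ 2 : ℝ) : ℂ) • u)) = 0 := by
    have h5 : ((lam ^ 2 * h' : ℝ) : ℂ) * (a + b * ((‖Ψ z‖ ^ 2 : ℝ) : ℂ)) = 1 := by
      exact_mod_cast h1
    have h6 : ∀ r c y : ℂ, r • ((b : ℂ) • (c • Ψ z - y • u))
        = r • ((a : ℂ) • u + ((b : ℂ) * c) • Ψ z) - (r * (a + b * y)) • u := by
      intro r c y; module
    rw [h6, h2, h5, one_smul, sub_self]
  rw [smul_eq_zero, smul_eq_zero, sub_eq_zero] at h4
  exact ((h4.resolve_left h3).resolve_left hb0).symm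

end IsRadialDuality

/-! ### The radial phase -/

/-- A function on a punctured ball whose derivative vanishes along the spheres is constant on each
sphere, because spheres of real dimension at least one are connected. -/
theorem eq_of_fderiv_eq_zero_of_norm_eq {n : ℕ} (hn : n ≠ 0) {F : Type*} [NormedAddCommGroup F]
    [NormedSpace ℝ F] {σ : Cn n → F} {ε : ℝ}
    (hd : ∀ z ∈ Metric.ball (0 : Cn n) ε, z ≠ 0 → DifferentiableAt ℝ σ z)
    (hσ : ∀ z ∈ Metric.ball (0 : Cn n) ε, z ≠ 0 → ∀ v, (inner ℂ z v).re = 0 → fderiv ℝ σ z v = 0)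
    {z w : Cn n} (hz : z ∈ Metric.ball (0 : Cn n) ε) (hz0 : z ≠ 0) (h : ‖z‖ = ‖w‖) :
    σ z = σ w := by
  have hr : 0 < ‖z‖ := norm_pos_iff.2 hz0
  set ρ : Cn n → Cn n := fun u => (‖z‖ / ‖u‖) • u with hρ
  have hρn : ∀ u ∈ ({0}ᶜ : Set (Cn n)), ‖ρ u‖ = ‖z‖ := by
    intro u hu
    rw [hρ]
    simp only
    rw [norm_smul, norm_div, norm_norm, norm_norm, div_mul_cancel₀ _ (norm_ne_zero_iff.2 hu)]
  have hρb : ∀ u ∈ ({0}ᶜ : Set (Cn n)), ρ u ∈ Metric.ball (0 : Cn n) ε ∧ ρ u ≠ 0 := by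
    intro u hu
    rw [mem_ball_zero_iff, ← norm_pos_iff, hρn u hu]
    exact ⟨mem_ball_zero_iff.1 hz, hr⟩
  have hρd : ∀ u ∈ ({0}ᶜ : Set (Cn n)), DifferentiableAt ℝ ρ u := by
    intro u hu
    have hu' : u ≠ 0 := hu
    have hu'' : ‖u‖ ≠ 0 := norm_ne_zero_iff.2 hu'
    have hn' : DifferentiableAt ℝ (fun u : Cn n => ‖u‖) u := differentiableAt_fun_id.norm ℝ hu'
    have hd' : DifferentiableAt ℝ (fun u : Cn n => ‖z‖ / ‖u‖) u := by
      simp only [div_eq_mul_inv]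
      exact (hn'.inv hu'').const_mul _
    exact hd'.smul differentiableAt_fun_id
  have hG : ∀ u ∈ ({0}ᶜ : Set (Cn n)), HasFDerivAt (σ ∘ ρ) (0 : Cn n →L[ℝ] F) u := by
    intro u hu
    obtain ⟨h1, h2⟩ := hρb u hu
    refine ((hd _ h1 h2).hasFDerivAt.comp u (hρd u hu).hasFDerivAt).congr_fderiv ?_
    ext v
    refine hσ _ h1 h2 _ ?_
    have h3 : HasFDerivAt (fun u => ‖ρ u‖ ^ 2) (0 : Cn n →L[ℝ] ℝ) u := by
      refine (hasFDerivAt_const (‖z‖ ^ 2) u).congr_of_eventuallyEq ?_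
      filter_upwards [isOpen_compl_singleton.mem_nhds hu] with u' hu'
      rw [hρn u' hu']
    have h4 := congrArg (fun L : Cn n →L[ℝ] ℝ => L v)
      ((hρd u hu).hasFDerivAt.norm_sq.unique h3)
    rw [← real_inner_eq_re]
    simpa using h4
  have hrank : 1 < Module.rank ℝ (Cn n) := by
    rw [← Module.finrank_eq_rank, ← Module.finrank_mul_finrank ℝ ℂ (Cn n)]
    simp only [finrank_real_complex, finrank_euclideanSpace, Fintype.card_fin]
    exact_mod_cast (by omega : 1 < 2 * n)
  have hw0 : w ≠ 0 := by rw [← norm_pos_iff, ← h]; exact hr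
  have := isOpen_compl_singleton.is_const_of_fderiv_eq_zero (𝕜 := ℝ)
    (isConnected_compl_singleton_of_one_lt_rank hrank (0 : Cn n)).isPreconnected
    (fun u hu => (hG u hu).differentiableAt.differentiableWithinAt)
    (fun u hu => (hG u hu).fderiv) (show z ∈ ({0}ᶜ : Set (Cn n)) from hz0)
    (show w ∈ ({0}ᶜ : Set (Cn n)) from hw0)
  simpa [hρ, ← h, hr.ne'] using this

namespace IsRadialDuality

variable {n : ℕ} {lam : ℝ} {f : ℝ → ℝ} {ε : ℝ} {Ψ : Cn n → Cn n}

/-- Along a ray the complex line through `Ψ` does not move, hence it is the image of the ray under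
the derivative at the origin. -/
theorem exists_apply_eq_smul (H : IsRadialDuality lam f ε Ψ)
    (hI : ∀ z ∈ Metric.ball (0 : Cn n) ε, fderiv ℝ Ψ z (I • z) = I • Ψ z)
    {z : Cn n} (hz : z ∈ Metric.ball (0 : Cn n) ε) (hz0 : z ≠ 0) :
    ∃ s : ℂ, Ψ z = s • fderiv ℝ Ψ 0 z := by
  set w := fderiv ℝ Ψ 0 z with hw
  have hw0 : w ≠ 0 := fun h => hz0 (H.fderiv_injective H.zero_mem (h.trans (_root_.map_zero _).symm))
  have hx : 0 < ‖z‖ := norm_pos_iff.2 hz0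
  have h1 : (1 : ℝ) < ε / ‖z‖ := by
    rw [one_lt_div hx]; exact mem_ball_zero_iff.1 hz
  have hmem : ∀ r ∈ Ioo 0 (ε / ‖z‖), r • z ∈ Metric.ball (0 : Cn n) ε := fun r hr => by
    rw [mem_ball_zero_iff, norm_smul, Real.norm_eq_abs, abs_of_pos hr.1]
    exact (lt_div_iff₀ hx).1 hr.2
  -- the squared cosine of the angle between `w` and `Ψ (r z)`
  set R : ℝ → ℝ := fun r => ‖inner ℂ w (Ψ (r • z))‖ ^ 2 / ‖Ψ (r • z)‖ ^ 2 with hR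
  have hder : ∀ r ∈ Ioo 0 (ε / ‖z‖), HasDerivAt R 0 r := by
    intro r hr
    have hb := hmem r hr
    have hrz : r • z ≠ 0 := smul_ne_zero hr.1.ne' hz0
    have hP0 : Ψ (r • z) ≠ 0 := H.apply_ne_zero hb hrz
    set P' := fderiv ℝ Ψ (r • z) z with hP'
    have hP : HasDerivAt (fun r : ℝ => Ψ (r • z)) P' r := by
      have h2 : HasDerivAt (fun s : ℝ => s • z) z r := by
        simpa using (hasDerivAt_id r).smul_const z
      exact (H.hasFDerivAt hb).comp_hasDerivAt r h2
    obtain ⟨μ, hμ⟩ : ∃ μ : ℂ, P' = μ • Ψ (r • z) := by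
      have h2 := H.norm_sq_smul_fderiv_self hI hb hrz
      have h3 : ((‖Ψ (r • z)‖ ^ 2 : ℝ) : ℂ) ≠ 0 := by
        exact_mod_cast (by positivity : ‖Ψ (r • z)‖ ^ 2 ≠ 0)
      have hr0 : (r : ℂ) ≠ 0 := by exact_mod_cast hr.1.ne'
      rw [map_smul, ← hP', ← Complex.coe_smul r P', smul_smul] at h2
      refine ⟨(((‖Ψ (r • z)‖ ^ 2 : ℝ) : ℂ) * r)⁻¹ * inner ℂ (Ψ (r • z)) ((r : ℂ) • P'), ?_⟩
      rw [mul_smul, ← h2, smul_smul, inv_mul_cancel₀ (mul_ne_zero h3 hr0), one_smul]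
    have hq : HasDerivAt (fun r : ℝ => inner ℂ w (Ψ (r • z))) (μ * inner ℂ w (Ψ (r • z))) r := by
      have h2 := (hasDerivAt_const r w).inner ℂ hP
      rwa [hμ, inner_zero_left, add_zero, inner_smul_right] at h2
    have hR' := hq.norm_sq.div hP.norm_sq (by positivity)
    refine hR'.congr_deriv ?_
    have e1 : inner ℝ (inner ℂ w (Ψ (r • z))) (μ * inner ℂ w (Ψ (r • z)))
        = μ.re * ‖inner ℂ w (Ψ (r • z))‖ ^ 2 := by
      rw [Complex.inner, mul_assoc, mul_conj, normSq_eq_norm_sq, mul_comm μ,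
        re_ofReal_mul, mul_comm]
    have e2 : inner ℝ (Ψ (r • z)) P' = μ.re * ‖Ψ (r • z)‖ ^ 2 := by
      rw [real_inner_eq_re, hμ, inner_smul_right, inner_self_eq_norm_sq_ofReal, mul_comm μ,
        re_ofReal_mul, mul_comm]
    rw [e1, e2]
    ring
  have hconst : ∀ r ∈ Ioo 0 (ε / ‖z‖), R r = R 1 := fun r hr =>
    isOpen_Ioo.is_const_of_deriv_eq_zero isPreconnected_Ioo
      (fun r hr => (hder r hr).differentiableAt.differentiableWithinAt)
      (fun r hr => (hder r hr).deriv) hr ⟨one_pos, h1⟩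
  have hlim : Tendsto R (𝓝[>] 0) (𝓝 (‖w‖ ^ 2)) := by
    have h2 : Tendsto (fun r : ℝ => r⁻¹ • Ψ (r • z)) (𝓝[>] 0) (𝓝 w) :=
      (H.tendsto_inv_smul_apply z).mono_left (nhdsWithin_mono _ fun x hx => ne_of_gt hx)
    have h3 := ((tendsto_const_nhds (x := w)).inner (𝕜 := ℂ) h2).norm.pow 2 |>.div (h2.norm.pow 2)
      (by positivity)
    have h4 : ‖inner ℂ w w‖ ^ 2 / ‖w‖ ^ 2 = ‖w‖ ^ 2 := by
      rw [inner_self_eq_norm_sq_ofReal, norm_real, Real.norm_eq_abs, abs_of_nonneg (by positivity)]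
      field_simp
    rw [h4] at h3
    refine h3.congr' ?_
    filter_upwards [self_mem_nhdsWithin] with r hr
    have hr0 : r ≠ 0 := ne_of_gt hr
    have hr1 : |r| ≠ 0 := abs_ne_zero.2 hr0
    simp only [Pi.div_apply, hR]
    rw [← Complex.coe_smul, inner_smul_right, norm_mul, norm_smul, norm_real, norm_inv,
      Real.norm_eq_abs, mul_pow, mul_pow, mul_div_mul_left _ _ (by positivity)]
  have hR1 : R 1 = ‖w‖ ^ 2 := by
    refine tendsto_nhds_unique (tendsto_const_nhds.congr' ?_) hlim
    filter_upwards [Ioo_mem_nhdsGT (lt_trans one_pos h1)] with r hr using (hconst r hr).symm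
  have hΨ0 := H.apply_ne_zero hz hz0
  have hCS : ‖inner ℂ w (Ψ z)‖ = ‖w‖ * ‖Ψ z‖ := by
    have h2 : 0 < ‖Ψ z‖ := norm_pos_iff.2 hΨ0
    simp only [hR, one_smul] at hR1
    rw [div_eq_iff (by positivity), ← mul_pow] at hR1
    exact (pow_left_inj₀ (norm_nonneg _) (by positivity) two_ne_zero).1 hR1
  obtain ⟨s, -, hs⟩ := (norm_inner_eq_norm_iff hw0 hΨ0).1 hCS
  exact ⟨s, hs⟩

theorem fderiv_zero_I_smul (H : IsRadialDuality lam f ε Ψ)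
    (hI : ∀ z ∈ Metric.ball (0 : Cn n) ε, fderiv ℝ Ψ z (I • z) = I • Ψ z) (v : Cn n) :
    fderiv ℝ Ψ 0 (I • v) = I • fderiv ℝ Ψ 0 v := by
  have hc : ContinuousAt (fderiv ℝ Ψ) 0 :=
    (H.contDiffOn.contDiffAt (Metric.isOpen_ball.mem_nhds H.zero_mem)).continuousAt_fderiv
      (by simp)
  have h1 : Tendsto (fun r : ℝ => r • v) (𝓝[≠] 0) (𝓝 0) := by
    have := (by fun_prop : Continuous fun r : ℝ => r • v).tendsto 0
    rw [zero_smul] at this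
    exact this.mono_left nhdsWithin_le_nhds
  have h2 : Tendsto (fun r : ℝ => fderiv ℝ Ψ (r • v) (I • v)) (𝓝[≠] 0)
      (𝓝 (fderiv ℝ Ψ 0 (I • v))) :=
    ((ContinuousLinearMap.apply ℝ (Cn n) (I • v)).continuous.tendsto _).comp
      (hc.tendsto.comp h1)
  refine tendsto_nhds_unique h2 (((H.tendsto_inv_smul_apply v).const_smul I).congr' ?_)
  filter_upwards [H.eventually_smul_mem v, self_mem_nhdsWithin] with r hr hr0
  rw [smul_comm, ← hI _ hr, smul_comm I r v, map_smul, smul_smul, inv_mul_cancel₀ hr0, one_smul]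

/-- The derivative at the origin is a positive multiple of a unitary map. -/
theorem exists_linearIsometry (H : IsRadialDuality lam f ε Ψ)
    (hI : ∀ z ∈ Metric.ball (0 : Cn n) ε, fderiv ℝ Ψ z (I • z) = I • Ψ z) :
    ∃ k > (0 : ℝ), ∃ A : Cn n →ₗᵢ[ℂ] Cn n, ∀ v, fderiv ℝ Ψ 0 v = (k : ℂ) • A v := by
  obtain ⟨k, hk, hn⟩ := H.exists_norm_fderiv_zero
  have hk' : (k : ℂ) ≠ 0 := by exact_mod_cast hk.ne'
  have hsmul : ∀ (c : ℂ) v, fderiv ℝ Ψ 0 (c • v) = c • fderiv ℝ Ψ 0 v := by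
    intro c v
    conv_lhs => rw [← re_add_im c, add_smul, mul_smul, Complex.coe_smul, Complex.coe_smul,
      map_add, map_smul, map_smul, H.fderiv_zero_I_smul hI]
    conv_rhs => rw [← re_add_im c, add_smul, mul_smul, Complex.coe_smul, Complex.coe_smul]
  let A : Cn n →ₗ[ℂ] Cn n :=
    { toFun := fun v => (k : ℂ)⁻¹ • fderiv ℝ Ψ 0 v
      map_add' := fun u v => by rw [map_add, smul_add]
      map_smul' := fun c v => by rw [hsmul, smul_comm, RingHom.id_apply] }
  refine ⟨k, hk, ⟨A, fun v => ?_⟩, fun v => ?_⟩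
  · change ‖(k : ℂ)⁻¹ • fderiv ℝ Ψ 0 v‖ = ‖v‖
    rw [norm_smul, hn, norm_inv, norm_real, Real.norm_eq_abs, abs_of_pos hk,
      inv_mul_cancel_left₀ hk.ne']
  · change _ = (k : ℂ) • ((k : ℂ)⁻¹ • fderiv ℝ Ψ 0 v)
    rw [smul_smul, mul_inv_cancel₀ hk', one_smul]

/-- If `Ψ = σ A` with `A` a linear isometry, then the derivative of `σ` vanishes along spheres: the
derivative of `Ψ` preserves symplectic orthogonality to the complex line through the base point. -/
theorem fderiv_factor_eq_zero (H : IsRadialDuality lam f ε Ψ)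
    (hI : ∀ z ∈ Metric.ball (0 : Cn n) ε, fderiv ℝ Ψ z (I • z) = I • Ψ z)
    {A : Cn n →ₗᵢ[ℂ] Cn n} {σ : Cn n → ℂ} {z : Cn n}
    (hz : z ∈ Metric.ball (0 : Cn n) ε) (hz0 : z ≠ 0) (hσ : DifferentiableAt ℝ σ z)
    (h : ∀ᶠ w in 𝓝 z, Ψ w = σ w • A w) {v : Cn n} (hv : (inner ℂ z v).re = 0) :
    fderiv ℝ σ z v = 0 := by
  have hA : HasFDerivAt (fun w => A w) (A.toContinuousLinearMap.restrictScalars ℝ) z :=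
    (A.toContinuousLinearMap.restrictScalars ℝ).hasFDerivAt
  have h1 : HasFDerivAt Ψ _ z := (hσ.hasFDerivAt.smul hA).congr_of_eventuallyEq h
  have h2 : fderiv ℝ Ψ z v = σ z • A v + fderiv ℝ σ z v • A z := by
    rw [h1.fderiv]; simp
  have hΨ : Ψ z = σ z • A z := h.self_of_nhds
  set s := (inner ℂ z v).im with hs
  have hzv : inner ℂ z v = I * s := by
    apply Complex.ext <;> simp [hv, hs]
  set x := ‖z‖ ^ 2 with hx
  have hx0 : 0 < x := by positivity
  set y := ‖Ψ z‖ ^ 2 with hy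
  have hyσ : (y : ℂ) = conj (σ z) * σ z * x := by
    rw [hy, hΨ, norm_smul, A.norm_map, mul_pow, ← normSq_eq_norm_sq, ofReal_mul, ← mul_conj]
    ring
  set p := lam * (deriv f (‖z‖ ^ 2) + deriv (deriv f) (‖z‖ ^ 2) * ‖z‖ ^ 2) with hp
  have hp0 : p ≠ 0 := (mul_pos H.lam_pos (H.deriv_add_pos z hz)).ne'
  have e1 : (inner ℂ (Ψ z) (fderiv ℝ Ψ z v)).re = 0 := by
    rw [H.re_inner_fderiv_of_equivariant hI hz, hv, mul_zero]
  have e2 : (inner ℂ (fderiv ℝ Ψ z z) (fderiv ℝ Ψ z v)).im = p * s := by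
    rw [H.pullback_flat z hz, radialForm_self_left]
    ring
  have e3 : (inner ℂ (Ψ z) (fderiv ℝ Ψ z z)).re = p * x := by
    rw [H.re_inner_fderiv_of_equivariant hI hz, inner_self_eq_norm_sq_ofReal, ofReal_re]
  have e4 := congrArg (fun u => (inner ℂ u (fderiv ℝ Ψ z v)).im)
    (H.norm_sq_smul_fderiv_self hI hz hz0)
  simp only [inner_smul_left, conj_ofReal, e2, mul_im, ofReal_re, ofReal_im, e1, conj_re, e3,
    mul_zero, zero_mul, add_zero] at e4
  have e5 : x * (inner ℂ (Ψ z) (fderiv ℝ Ψ z v)).im = y * s := by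
    refine mul_left_cancel₀ hp0 ?_
    linear_combination -e4
  have e6 : (x : ℂ) * inner ℂ (Ψ z) (fderiv ℝ Ψ z v) = I * (y * s) := by
    rw [← re_add_im (inner ℂ (Ψ z) (fderiv ℝ Ψ z v)), e1]
    have : (x : ℂ) * ((inner ℂ (Ψ z) (fderiv ℝ Ψ z v)).im : ℂ) = y * s := by exact_mod_cast e5
    rw [← this]; push_cast; ring
  rw [h2, hΨ, inner_smul_left, inner_add_right, inner_smul_right, inner_smul_right,
    A.inner_map_map, A.inner_map_map, inner_self_eq_norm_sq_ofReal, hzv, hyσ] at e6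
  have hσ0 : conj (σ z) ≠ 0 := by
    intro h0
    have h3 : σ z = 0 := by simpa using h0
    refine H.apply_ne_zero hz hz0 ?_
    rw [hΨ, h3, zero_smul]
  have hxC : (x : ℂ) ≠ 0 := by exact_mod_cast hx0.ne'
  have e7 : conj (σ z) * (x * x) * fderiv ℝ σ z v = 0 := by
    linear_combination e6
  exact (mul_eq_zero.1 e7).resolve_left (mul_ne_zero hσ0 (mul_ne_zero hxC hxC))

/-- A duality in local normal form is a unitary map times `(lam f')^{1/2}` and a radial phase. -/
theorem exists_radial_phase (H : IsRadialDuality lam f ε Ψ)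
    (hI : ∀ z ∈ Metric.ball (0 : Cn n) ε, fderiv ℝ Ψ z (I • z) = I • Ψ z) :
    ∃ g : Cn n → ℝ, IsRadialOn (Metric.ball 0 ε) g ∧ ∃ A : Cn n →ₗᵢ[ℂ] Cn n,
      ∀ z ∈ Metric.ball (0 : Cn n) ε,
        Ψ z = (cexp (I * (g z : ℂ)) * (Real.sqrt (lam * deriv f (‖z‖ ^ 2)) : ℂ)) • A z := by
  obtain ⟨k, hk, A, hA⟩ := H.exists_linearIsometry hI
  set σ : Cn n → ℂ := fun z => ((‖z‖ ^ 2 : ℝ) : ℂ)⁻¹ * inner ℂ (A z) (Ψ z) with hσ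
  have hx : ∀ {z : Cn n}, z ≠ 0 → ((‖z‖ ^ 2 : ℝ) : ℂ) ≠ 0 := fun hz => by
    exact_mod_cast (by positivity : ‖_‖ ^ 2 ≠ (0 : ℝ))
  have hfac : ∀ z ∈ Metric.ball (0 : Cn n) ε, z ≠ 0 → Ψ z = σ z • A z := by
    intro z hz hz0
    obtain ⟨s, hs⟩ := H.exists_apply_eq_smul hI hz hz0
    rw [hA, smul_smul] at hs
    rw [hσ]
    simp only
    rw [hs, inner_smul_right, inner_self_eq_norm_sq_ofReal, A.norm_map, mul_comm (s * k),
      inv_mul_cancel_left₀ (hx hz0)]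
  have hσd : ∀ z ∈ Metric.ball (0 : Cn n) ε, z ≠ 0 → DifferentiableAt ℝ σ z := by
    intro z hz hz0
    have h1 : DifferentiableAt ℝ (fun w : Cn n => ((‖w‖ ^ 2 : ℝ) : ℂ)) z :=
      ofRealCLM.differentiableAt.comp z (analyticAt_norm_sq z).differentiableAt
    have hA' : DifferentiableAt ℝ (fun w => A w) z :=
      (A.toContinuousLinearMap.restrictScalars ℝ).differentiableAt
    exact (h1.inv (hx hz0)).mul (hA'.inner ℂ (H.differentiableAt hz))
  have hrad : ∀ z ∈ Metric.ball (0 : Cn n) ε, ∀ w ∈ Metric.ball (0 : Cn n) ε,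
      ‖z‖ ^ 2 = ‖w‖ ^ 2 → σ z = σ w := by
    intro z hz w hw h
    have h' : ‖z‖ = ‖w‖ := (pow_left_inj₀ (norm_nonneg _) (norm_nonneg _) two_ne_zero).1 h
    by_cases hz0 : z = 0
    · have : w = 0 := by rw [← norm_eq_zero, ← h', hz0, norm_zero]
      rw [hz0, this]
    · refine eq_of_fderiv_eq_zero_of_norm_eq H.dim_ne_zero hσd (fun u hu hu0 v hv => ?_) hz hz0 h'
      refine H.fderiv_factor_eq_zero (A := A) hI hu hu0 (hσd u hu hu0) ?_ hv
      filter_upwards [Metric.isOpen_ball.mem_nhds hu, isOpen_compl_singleton.mem_nhds hu0]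
        with w hw hw0 using hfac w hw hw0
  refine ⟨fun z => arg (σ z), fun z hz w hw h => by simp only [hrad z hz w hw h], A,
    fun z hz => ?_⟩
  by_cases hz0 : z = 0
  · rw [hz0, H.map_zero, _root_.map_zero, smul_zero]
  · have h1 := H.norm_sq_apply_of_equivariant hI hz
    rw [hfac z hz hz0, norm_smul, A.norm_map] at h1
    have h2 : ‖σ z‖ = Real.sqrt (lam * deriv f (‖z‖ ^ 2)) := by
      rw [eq_comm, Real.sqrt_eq_iff_mul_self_eq
        (mul_pos H.lam_pos (H.deriv_pos z hz)).le (norm_nonneg _)]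
      have hx0 : ‖z‖ ^ 2 ≠ 0 := by positivity
      refine mul_right_cancel₀ hx0 ?_
      linear_combination -h1
    rw [← h2, mul_comm, mul_comm I, norm_mul_exp_arg_mul_I]
    exact hfac z hz hz0

end IsRadialDuality

/-! ### Unitary matrices and radial scalings -/

theorem exists_mem_unitaryGroup_toEuclideanLin_eq {n : ℕ} (T : Cn n →ₗᵢ[ℂ] Cn n) :
    ∃ A ∈ Matrix.unitaryGroup (Fin n) ℂ, ∀ z, Matrix.toEuclideanLin A z = T z := by
  set A := Matrix.toEuclideanLin.symm T.toLinearMap with hA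
  have hAT : Matrix.toEuclideanLin A = T.toLinearMap := by
    rw [hA, LinearEquiv.apply_symm_apply]
  refine ⟨A, ?_, fun z => by rw [hAT]; rfl⟩
  rw [Matrix.mem_unitaryGroup_iff']
  ext j k
  have h := T.inner_map_map (EuclideanSpace.single j (1 : ℂ)) (EuclideanSpace.single k 1)
  have h1 : ∀ i l, T (EuclideanSpace.single i (1 : ℂ)) l = A l i := by
    intro i l
    have := congrArg (fun L : Cn n →ₗ[ℂ] Cn n => L (EuclideanSpace.single i (1 : ℂ)) l) hAT
    simpa [Matrix.toLpLin_apply] using this.symm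
  rw [inner_eq_sum_conj_mul] at h
  simp only [h1] at h
  rw [Matrix.star_eq_conjTranspose, Matrix.mul_apply]
  simp only [Matrix.conjTranspose_apply, RCLike.star_def, Matrix.one_apply]
  rw [h, EuclideanSpace.inner_single_left, EuclideanSpace.single, PiLp.single_apply]
  simp

/-- The map `z ↦ (lam φ'(|z|²))^{1/2} z`. -/
noncomputable def radialScaling {n : ℕ} (lam : ℝ) (φ : ℝ → ℝ) (z : Cn n) : Cn n :=
  Real.sqrt (lam * deriv φ (‖z‖ ^ 2)) • z

theorem analyticAt_sqrt_mul_deriv {n : ℕ} {lam : ℝ} {φ : ℝ → ℝ} {z : Cn n}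
    (hφ : AnalyticAt ℝ φ (‖z‖ ^ 2)) (hpos : 0 < lam * deriv φ (‖z‖ ^ 2)) :
    AnalyticAt ℝ (fun z : Cn n => Real.sqrt (lam * deriv φ (‖z‖ ^ 2))) z := by
  have h : AnalyticAt ℝ (fun z : Cn n => lam * deriv φ (‖z‖ ^ 2)) z :=
    analyticAt_const.mul (AnalyticAt.fun_comp hφ.deriv (analyticAt_norm_sq z))
  exact ((h.contDiffAt (n := ω)).sqrt hpos.ne').analyticAt

theorem contDiffAt_radialScaling {n : ℕ} {lam : ℝ} {φ : ℝ → ℝ} {z : Cn n}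
    (hφ : AnalyticAt ℝ φ (‖z‖ ^ 2)) (hpos : 0 < lam * deriv φ (‖z‖ ^ 2)) :
    ContDiffAt ℝ ∞ (radialScaling (n := n) lam φ) z :=
  (analyticAt_sqrt_mul_deriv hφ hpos).contDiffAt.smul contDiffAt_id

theorem norm_sq_radialScaling {n : ℕ} {lam : ℝ} {φ : ℝ → ℝ} {z : Cn n}
    (hpos : 0 < lam * deriv φ (‖z‖ ^ 2)) :
    ‖radialScaling lam φ z‖ ^ 2 = lam * deriv φ (‖z‖ ^ 2) * ‖z‖ ^ 2 := by
  rw [radialScaling, norm_smul, mul_pow, Real.norm_eq_abs, sq_abs, Real.sq_sqrt hpos.le]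

theorem radialScaling_radialScaling {n : ℕ} {lam : ℝ} {φ χ : ℝ → ℝ} {z : Cn n}
    (hpos : 0 < lam * deriv φ (‖z‖ ^ 2))
    (h : lam ^ 2 * deriv φ (‖z‖ ^ 2) * deriv χ (lam * deriv φ (‖z‖ ^ 2) * ‖z‖ ^ 2) = 1) :
    radialScaling lam χ (radialScaling lam φ z) = z := by
  have h1 : radialScaling lam χ (radialScaling lam φ z)
      = Real.sqrt (lam * deriv χ (‖radialScaling lam φ z‖ ^ 2)) • radialScaling lam φ z := rfl
  rw [h1, norm_sq_radialScaling hpos, radialScaling, smul_smul, mul_comm,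
    ← Real.sqrt_mul hpos.le]
  have h2 : lam * deriv φ (‖z‖ ^ 2) * (lam * deriv χ (lam * deriv φ (‖z‖ ^ 2) * ‖z‖ ^ 2)) = 1 := by
    linear_combination h
  rw [h2, Real.sqrt_one, one_smul]

/-- The radial scaling pulls the flat form back to `lam` times the form with potential
`φ(|z|²)`. -/
theorem im_inner_fderiv_radialScaling {n : ℕ} {lam : ℝ} {φ : ℝ → ℝ} {z : Cn n}
    (hφ : AnalyticAt ℝ φ (‖z‖ ^ 2)) (hpos : 0 < lam * deriv φ (‖z‖ ^ 2)) (v w : Cn n) :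
    (inner ℂ (fderiv ℝ (radialScaling lam φ) z v) (fderiv ℝ (radialScaling lam φ) z w)).im
      = lam * radialForm (deriv φ (‖z‖ ^ 2)) (deriv (deriv φ) (‖z‖ ^ 2)) z v w := by
  set c := Real.sqrt (lam * deriv φ (‖z‖ ^ 2)) with hc
  have hc0 : c ≠ 0 := (Real.sqrt_pos.2 hpos).ne'
  have hc2 : c * c = lam * deriv φ (‖z‖ ^ 2) := Real.mul_self_sqrt hpos.le
  have h1 : HasDerivAt (fun x => Real.sqrt (lam * deriv φ x))
      (lam * deriv (deriv φ) (‖z‖ ^ 2) / (2 * c)) (‖z‖ ^ 2) :=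
    (hφ.deriv.differentiableAt.hasDerivAt.const_mul lam).sqrt hpos.ne'
  have h2 : HasFDerivAt (radialScaling (n := n) lam φ) _ z :=
    (hasFDerivAt_comp_norm_sq h1.differentiableAt).smul (hasFDerivAt_id z)
  have h3 : ∀ u, fderiv ℝ (radialScaling lam φ) z u
      = (c : ℂ) • u + ((lam * deriv (deriv φ) (‖z‖ ^ 2) / c * (inner ℂ z u).re : ℝ) : ℂ) • z := by
    intro u
    rw [h2.fderiv, Complex.coe_smul, Complex.coe_smul]
    simp only [h1.deriv, add_apply, smul_apply, ContinuousLinearMap.smulRight_apply,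
      innerSL_apply_apply, real_inner_eq_re, ContinuousLinearMap.id_apply, smul_eq_mul, ← hc]
    congr 2
    field_simp
  rw [h3, h3, inner_add_left, inner_add_right, inner_add_right]
  simp only [inner_smul_left, inner_smul_right, conj_ofReal, add_im, im_ofReal_mul]
  rw [inner_self_eq_norm_sq_ofReal, ofReal_im, ← inner_conj_symm v z, radialForm, conj_im, mul_im,
    conj_re, conj_im]
  field_simp
  linear_combination (inner ℂ v w).im * c ^ 2 * hc2

/-! ### Dualities between a potential and its dual -/

theorem deriv_neg_comp_neg (f : ℝ → ℝ) (y : ℝ) : deriv (fun y => -f (-y)) y = deriv f (-y) := by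
  rw [deriv.fun_neg, deriv_comp_neg, neg_neg]

theorem deriv_deriv_neg_comp_neg (f : ℝ → ℝ) (y : ℝ) :
    deriv (deriv fun y => -f (-y)) y = -deriv (deriv f) (-y) := by
  rw [funext (deriv_neg_comp_neg f), deriv_comp_neg]

theorem analyticAt_neg_comp_neg {f : ℝ → ℝ} {y : ℝ} (hf : AnalyticAt ℝ f (-y)) :
    AnalyticAt ℝ (fun y => -f (-y)) y :=
  (AnalyticAt.fun_comp hf analyticAt_id.neg).neg

theorem eventually_norm_sq {n : ℕ} {p : ℝ → Prop} (h : ∀ᶠ x in 𝓝 (0 : ℝ), p x) :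
    ∀ᶠ z : Cn n in 𝓝 0, p (‖z‖ ^ 2) := by
  have ht : Tendsto (fun z : Cn n => ‖z‖ ^ 2) (𝓝 0) (𝓝 0) := by
    simpa using (by fun_prop : Continuous fun z : Cn n => ‖z‖ ^ 2).tendsto 0
  exact ht.eventually h

theorem eventually_neg_norm_sq {n : ℕ} {p : ℝ → Prop} (h : ∀ᶠ x in 𝓝 (0 : ℝ), p x) :
    ∀ᶠ z : Cn n in 𝓝 0, p (-‖z‖ ^ 2) := by
  have ht : Tendsto (fun x : ℝ => -x) (𝓝 0) (𝓝 0) := by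
    simpa using (continuous_neg (G := ℝ)).tendsto 0
  exact eventually_norm_sq (p := fun x => p (-x)) (ht.eventually h)

section Potential

variable {n : ℕ} {M Mstar : Set (Cn n)} {Φ Φstar : Cn n → ℝ} {f : ℝ → ℝ}

theorem NowhereProportional.dim_ne_zero (hM : IsComplexDomain M) (h : NowhereProportional M Φ) :
    n ≠ 0 := by
  rintro rfl
  refine h ⟨M, subset_rfl, hM.1, hM.2.1.nonempty, 0, fun z _ v w => ?_⟩
  simp [kahlerForm, flatForm]

theorem IsAssociatedFunction.analyticAt_zero (hM : IsComplexDomain M)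
    (hf : IsAssociatedFunction M Φ f) : AnalyticAt ℝ f 0 := by
  simpa using hf.1 _ (mem_image_of_mem _ hM.2.2)

theorem IsAssociatedFunction.eventually_eq (hM : IsComplexDomain M)
    (hf : IsAssociatedFunction M Φ f) {z : Cn n} (hz : z ∈ M) :
    ∀ᶠ w in 𝓝 z, Φ w = f (‖w‖ ^ 2) := by
  filter_upwards [hM.1.mem_nhds hz] with w hw using hf.2 w hw

theorem IsAssociatedFunction.kahlerForm_eq (hM : IsComplexDomain M)
    (hf : IsAssociatedFunction M Φ f) {z : Cn n} (hz : z ∈ M) (v w : Cn n) :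
    kahlerForm Φ z v w
      = (radialForm (deriv f (‖z‖ ^ 2)) (deriv (deriv f) (‖z‖ ^ 2)) z v w : ℂ) :=
  kahlerForm_of_radial (hf.1 _ (mem_image_of_mem _ hz)) (hf.eventually_eq hM hz) v w

theorem IsAssociatedFunction.deriv_zero_pos (hM : IsComplexDomain M)
    (hΦ : IsKahlerPotential M Φ) (hf : IsAssociatedFunction M Φ f) (hn : n ≠ 0) :
    0 < deriv f 0 := by
  set j₀ : Fin n := ⟨0, Nat.pos_of_ne_zero hn⟩
  have h := hΦ.2 0 hM.2.2 (EuclideanSpace.single j₀ 1) (by simp)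
  simp only [complexHessian_of_radial (hf.1 _ (mem_image_of_mem _ hM.2.2))
    (hf.eventually_eq hM hM.2.2)] at h
  simpa [EuclideanSpace.single, PiLp.single_apply] using h

/-- If `f'` were constant near `0`, then `ω` would be a multiple of the flat form there. -/
theorem NowhereProportional.not_eventually_deriv_eq (hM : IsComplexDomain M)
    (hf : IsAssociatedFunction M Φ f) (h : NowhereProportional M Φ) :
    ¬ ∀ᶠ x in 𝓝 (0 : ℝ), deriv f x = deriv f 0 := by
  intro hc
  obtain ⟨ε, hε, hb⟩ := Metric.eventually_nhds_iff_ball.1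
    ((eventually_norm_sq (n := n) hc.eventually_nhds).and (hM.1.mem_nhds hM.2.2))
  refine h ⟨Metric.ball 0 ε, fun z hz => (hb z hz).2, Metric.isOpen_ball,
    ⟨0, Metric.mem_ball_self hε⟩, deriv f 0, fun z hz v w => ?_⟩
  obtain ⟨h1, h2⟩ := hb z hz
  have h3 : deriv (deriv f) (‖z‖ ^ 2) = 0 := by
    rw [EventuallyEq.deriv_eq (f := fun _ => deriv f 0) h1, deriv_const]
  rw [hf.kahlerForm_eq hM h2, flatForm_eq_im_inner, h3, h1.self_of_nhds, radialForm]
  push_cast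
  ring

theorem kahlerForm_of_eventually_eq_neg {z : Cn n} (hf : AnalyticAt ℝ f (-‖z‖ ^ 2))
    (h : ∀ᶠ w in 𝓝 z, Φstar w = -f (-‖w‖ ^ 2)) (v w : Cn n) :
    kahlerForm Φstar z v w
      = (radialForm (deriv f (-‖z‖ ^ 2)) (-deriv (deriv f) (-‖z‖ ^ 2)) z v w : ℂ) := by
  rw [kahlerForm_of_radial (φ := fun y => -f (-y)) (analyticAt_neg_comp_neg hf) h,
    deriv_neg_comp_neg, deriv_deriv_neg_comp_neg]

/-- Every symplectic duality is in local normal form near the origin. -/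
theorem IsSymplecticDuality.exists_isRadialDuality {lam : ℝ} {U Ustar : Set (Cn n)}
    {Ψ : Cn n → Cn n} (hM : IsComplexDomain M) (hΦ : IsKahlerPotential M Φ)
    (hf : IsAssociatedFunction M Φ f) (hdual : IsLocalDual Φ Mstar Φstar)
    (hnp : NowhereProportional M Φ) (hlam : 0 < lam)
    (hΨ : IsSymplecticDuality lam M Φ Mstar Φstar U Ustar Ψ) :
    ∃ ε > 0, Metric.ball 0 ε ⊆ U ∧ IsRadialDuality lam f ε Ψ := by
  have hn := hnp.dim_ne_zero hM
  have hf0 := hf.analyticAt_zero hM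
  have hf' := hf.deriv_zero_pos hM hΦ hn
  have hfc := hnp.not_eventually_deriv_eq hM hf
  have hstar := hdual.eventually_eq_neg hf0 (hf.eventually_eq hM hM.2.2)
  obtain ⟨hUo, hVo, hmaps, hsmooth, Θ, -, hΘsmooth, hinv⟩ := hΨ.diffeo
  have h0U := hΨ.zero_mem_left
  have hU := hUo.mem_nhds h0U
  have hc0 : ContinuousAt Ψ 0 := hsmooth.continuousOn.continuousAt hU
  have hflat : ∀ z ∈ U, ∀ v w : Cn n, (inner ℂ (fderiv ℝ Ψ z v) (fderiv ℝ Ψ z w)).im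
      = lam * radialForm (deriv f (‖z‖ ^ 2)) (deriv (deriv f) (‖z‖ ^ 2)) z v w := by
    intro z hz v w
    have h := hΨ.pullback_flat z hz v w
    rw [flatForm_eq_im_inner, hf.kahlerForm_eq hM (hΨ.subset_left hz)] at h
    exact_mod_cast h
  have hder : ∀ᶠ x in 𝓝 (0 : ℝ), AnalyticAt ℝ f x ∧ 0 < deriv f x ∧
      0 < deriv f x + deriv (deriv f) x * x := by
    refine hf0.eventually_analyticAt.and
      ((hf0.deriv.continuousAt.eventually (lt_mem_nhds hf')).and ?_)
    have h1 : ContinuousAt (fun x => deriv f x + deriv (deriv f) x * x) 0 :=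
      hf0.deriv.continuousAt.add (hf0.deriv.deriv.continuousAt.mul continuousAt_id)
    exact h1.eventually (lt_mem_nhds (by simpa using hf'))
  -- the trace of `lam ω*`, its radial expression near the origin, and its pull-back by `Ψ`
  set e := stdOrthonormalBasis ℝ (Cn n)
  set τ : Cn n → ℂ := fun w => lam * ∑ i, kahlerForm Φstar w (e i) (I • e i) with hτ
  set T : ℝ → ℝ := fun y =>
    lam * (2 * (n * deriv f (-y) + -deriv (deriv f) (-y) * y)) with hT
  set S : ℝ → ℝ := fun x => 2 * (n / (lam * deriv f x)
    - deriv (deriv f) x * x / (lam * deriv f x * (deriv f x + deriv (deriv f) x * x))) with hS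
  have hφ0 : AnalyticAt ℝ (fun y => -f (-y)) 0 := analyticAt_neg_comp_neg (by simpa using hf0)
  have hTφ : ∀ y, T y = 2 * lam * (n * deriv (fun y => -f (-y)) y
      + y * deriv (deriv fun y => -f (-y)) y) := by
    intro y
    rw [deriv_neg_comp_neg, deriv_deriv_neg_comp_neg, hT]
    ring
  have hTa : AnalyticAt ℝ T 0 := by
    rw [funext hTφ]
    exact analyticAt_const.mul ((analyticAt_const.mul hφ0.deriv).add
      (analyticAt_id.mul hφ0.deriv.deriv))
  have hTc : ¬ ∀ᶠ y in 𝓝 (0 : ℝ), T y = T 0 := by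
    intro h
    refine hfc ?_
    have h1 := eventually_deriv_eq_of_trace_eq_const hn hφ0 (c := T 0 / (2 * lam)) (by
      filter_upwards [h] with y hy
      rw [← hy, hTφ, mul_div_cancel_left₀ _ (by positivity)])
    have ht : Tendsto (fun x : ℝ => -x) (𝓝 0) (𝓝 0) := by
      simpa using (continuous_neg (G := ℝ)).tendsto 0
    filter_upwards [ht.eventually h1] with x hx
    simpa [deriv_neg_comp_neg] using hx
  have hSa : AnalyticAt ℝ S 0 := by
    have h1 : AnalyticAt ℝ (fun x => deriv (deriv f) x * x) 0 := hf0.deriv.deriv.mul analyticAt_id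
    have h2 : AnalyticAt ℝ (fun x => lam * deriv f x) 0 := analyticAt_const.mul hf0.deriv
    have h3 : lam * deriv f 0 ≠ 0 := by positivity
    exact analyticAt_const.mul ((analyticAt_const.div h2 h3).sub
      (h1.div (h2.mul (hf0.deriv.add h1)) (by simpa using ⟨hlam.ne', hf'.ne'⟩)))
  have hτT : ∀ᶠ w : Cn n in 𝓝 0, τ w = (T (‖w‖ ^ 2) : ℂ) := by
    filter_upwards [hstar.eventually_nhds, eventually_neg_norm_sq hf0.eventually_analyticAt]
      with w hw hfw
    rw [hτ, hT]
    simp only [kahlerForm_of_eventually_eq_neg hfw hw]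
    rw [← ofReal_sum, sum_radialForm_I_smul, ← ofReal_mul]
  have hτS : ∀ᶠ z : Cn n in 𝓝 0, τ (Ψ z) = (S (‖z‖ ^ 2) : ℂ) := by
    filter_upwards [hU, eventually_norm_sq hder] with z hz ⟨_, h1, h2⟩
    exact sum_dual_I_smul_eq e hlam.ne' h1.ne' h2.ne' (fderiv ℝ Ψ z) (kahlerForm Φstar (Ψ z))
      (hflat z hz) fun v w => by rw [hΨ.pullback_dual z hz, flatForm_eq_im_inner]
  have hτa : AnalyticOnNhd ℝ τ Mstar := fun w hw =>
    analyticAt_const.mul (Finset.analyticAt_fun_sum _ fun i _ =>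
      analyticOnNhd_kahlerForm hdual.2.1.1 _ _ w hw)
  have hΨ0 : Ψ 0 = 0 := map_zero_of_radial_invariant hdual.1.1 hdual.1.2.1.isPreconnected
    hdual.1.2.2 hτa hτT hTa hTc hSa hVo hΨ.subset_right h0U hmaps hΘsmooth.continuousOn hinv hτS
  have hΨt : Tendsto Ψ (𝓝 0) (𝓝 0) := by
    have := hc0.tendsto
    rwa [hΨ0] at this
  obtain ⟨η, hη, hTinj⟩ := hTa.exists_injOn_Ico hTc
  have hf2 : ∀ᶠ x in 𝓝 (0 : ℝ), x ≠ 0 → deriv (deriv f) x ≠ 0 :=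
    eventually_nhdsWithin_iff.1
      (hf0.deriv.deriv.eventually_eq_zero_or_eventually_ne_zero.resolve_left fun h =>
        hfc (hf0.deriv.eventually_eq_of_deriv_eq_zero h))
  obtain ⟨ε, hε, hb⟩ := Metric.eventually_nhds_iff_ball.1
    (((eventually_mem_set.2 hU).and (eventually_norm_sq hder)).and
      ((hΨt.eventually (hτT.and (hstar.eventually_nhds.and
        ((eventually_neg_norm_sq hf0.eventually_analyticAt).and
          ((eventually_neg_norm_sq hf2).and (eventually_norm_sq (gt_mem_nhds hη))))))).and hτS))
  have hinj : InjOn Ψ U := hinv.1.injOn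
  refine ⟨ε, hε, fun z hz => (hb z hz).1.1, ?_⟩
  exact
    { dim_ne_zero := hn
      lam_pos := hlam
      radius_pos := hε
      contDiffOn := hsmooth.mono fun z hz => (hb z hz).1.1
      injOn := hinj.mono fun z hz => (hb z hz).1.1
      map_zero := hΨ0
      norm_map_eq := by
        intro z hz w hw h
        obtain ⟨-, ⟨h1, -, -, -, h2⟩, h3⟩ := hb z hz
        obtain ⟨-, ⟨h1', -, -, -, h2'⟩, h3'⟩ := hb w hw
        rw [← h, ← h3, h1, h1'] at h3'
        exact (pow_left_inj₀ (norm_nonneg _) (norm_nonneg _) two_ne_zero).1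
          (hTinj ⟨by positivity, h2'⟩ ⟨by positivity, h2⟩ (ofReal_injective h3')).symm
      pullback_flat := fun z hz => hflat z (hb z hz).1.1
      pullback_dual := by
        intro z hz v w
        obtain ⟨⟨h0, -⟩, ⟨-, h1, h2, -, -⟩, -⟩ := hb z hz
        have h := hΨ.pullback_dual z h0 v w
        rw [flatForm_eq_im_inner, kahlerForm_of_eventually_eq_neg h2 h1] at h
        exact_mod_cast h
      analyticAt := fun z hz => (hb z hz).1.2.1
      deriv_pos := fun z hz => (hb z hz).1.2.2.1
      deriv_add_pos := fun z hz => (hb z hz).1.2.2.2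
      deriv_deriv_ne_zero := by
        intro z hz hz0
        obtain ⟨⟨h0, -⟩, ⟨-, -, -, h1, -⟩, -⟩ := hb z hz
        refine h1 ?_
        have : Ψ z ≠ 0 := fun h => hz0 (hinj h0 h0U (h.trans hΨ0.symm))
        simpa using this }

/-- If the functional equation holds, the radial scaling is a symplectic duality. Its inverse is the
radial scaling of the dual potential, and both pull-back identities are instances of the same
formula. -/
theorem exists_isSymplecticDuality {lam : ℝ} (hM : IsComplexDomain M)
    (hΦ : IsKahlerPotential M Φ) (hf : IsAssociatedFunction M Φ f)
    (hdual : IsLocalDual Φ Mstar Φstar) (hn : n ≠ 0) (hlam : 0 < lam)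
    (h : ∀ᶠ x : ℝ in 𝓝 0, lam ^ 2 * deriv f x * deriv f (-(lam * x * deriv f x)) = 1) :
    ∃ (U Ustar : Set (Cn n)) (Ψ : Cn n → Cn n),
      IsSymplecticDuality lam M Φ Mstar Φstar U Ustar Ψ := by
  have hf0 := hf.analyticAt_zero hM
  have hf' := hf.deriv_zero_pos hM hΦ hn
  have hstar := hdual.eventually_eq_neg hf0 (hf.eventually_eq hM hM.2.2)
  have hder : ∀ᶠ x in 𝓝 (0 : ℝ), AnalyticAt ℝ f x ∧ 0 < lam * deriv f x ∧
      lam ^ 2 * deriv f x * deriv f (-(lam * x * deriv f x)) = 1 := by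
    refine hf0.eventually_analyticAt.and (Eventually.and ?_ h)
    filter_upwards [hf0.deriv.continuousAt.eventually (lt_mem_nhds hf')] with x hx
    exact mul_pos hlam hx
  obtain ⟨ε, hε, hb⟩ := Metric.eventually_nhds_iff_ball.1
    (((eventually_norm_sq (n := n) hder).and (eventually_neg_norm_sq hder)).and
      (hstar.eventually_nhds.and ((eventually_mem_set.2 (hM.1.mem_nhds hM.2.2)).and
        (eventually_mem_set.2 (hdual.1.1.mem_nhds hdual.1.2.2)))))
  set φ : ℝ → ℝ := fun y => -f (-y) with hφ
  have hφ' : ∀ y, deriv φ y = deriv f (-y) := deriv_neg_comp_neg f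
  set B := Metric.ball (0 : Cn n) ε
  set Ψ : Cn n → Cn n := radialScaling lam f with hΨdef
  set Θ : Cn n → Cn n := radialScaling lam φ with hΘdef
  have hfa : ∀ z ∈ B, AnalyticAt ℝ f (‖z‖ ^ 2) := fun z hz => (hb z hz).1.1.1
  have hfp : ∀ z ∈ B, 0 < lam * deriv f (‖z‖ ^ 2) := fun z hz => (hb z hz).1.1.2.1
  have hφa : ∀ z ∈ B, AnalyticAt ℝ φ (‖z‖ ^ 2) := fun z hz =>
    analyticAt_neg_comp_neg (hb z hz).1.2.1
  have hφp : ∀ z ∈ B, 0 < lam * deriv φ (‖z‖ ^ 2) := fun z hz => by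
    rw [hφ']; exact (hb z hz).1.2.2.1
  have hΨs : ContDiffOn ℝ ∞ Ψ B := fun z hz =>
    (contDiffAt_radialScaling (hfa z hz) (hfp z hz)).contDiffWithinAt
  have hΘs : ContDiffOn ℝ ∞ Θ B := fun z hz =>
    (contDiffAt_radialScaling (hφa z hz) (hφp z hz)).contDiffWithinAt
  have hΘΨ : ∀ z ∈ B, Θ (Ψ z) = z := fun z hz => by
    refine radialScaling_radialScaling (hfp z hz) ?_
    rw [hφ', ← (hb z hz).1.1.2.2]
    congr 3
    ring
  have hΨΘ : ∀ z ∈ B, Ψ (Θ z) = z := fun z hz => by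
    refine radialScaling_radialScaling (hφp z hz) ?_
    rw [hφ', ← (hb z hz).1.2.2.2]
    congr 2
    ring
  set U := B ∩ Ψ ⁻¹' B with hU
  set V := B ∩ Θ ⁻¹' B with hV
  have hUo : IsOpen U :=
    hΨs.continuousOn.isOpen_inter_preimage Metric.isOpen_ball Metric.isOpen_ball
  have hVo : IsOpen V :=
    hΘs.continuousOn.isOpen_inter_preimage Metric.isOpen_ball Metric.isOpen_ball
  have hUV : MapsTo Ψ U V := fun z hz => ⟨hz.2, by rw [mem_preimage, hΘΨ z hz.1]; exact hz.1⟩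
  have hVU : MapsTo Θ V U := fun z hz => ⟨hz.2, by rw [mem_preimage, hΨΘ z hz.1]; exact hz.1⟩
  have h0 : (0 : Cn n) ∈ B := Metric.mem_ball_self hε
  have hΨ0 : Ψ 0 = 0 := smul_zero _
  have hΘ0 : Θ 0 = 0 := smul_zero _
  have hflat : ∀ z ∈ B, ∀ v w : Cn n,
      flatForm (fderiv ℝ Ψ z v) (fderiv ℝ Ψ z w) = lam * kahlerForm Φ z v w := by
    intro z hz v w
    rw [flatForm_eq_im_inner, im_inner_fderiv_radialScaling (hfa z hz) (hfp z hz),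
      hf.kahlerForm_eq hM (hb z hz).2.2.1, ofReal_mul]
  have hflat' : ∀ z ∈ B, ∀ v w : Cn n,
      flatForm (fderiv ℝ Θ z v) (fderiv ℝ Θ z w) = lam * kahlerForm Φstar z v w := by
    intro z hz v w
    rw [flatForm_eq_im_inner, im_inner_fderiv_radialScaling (hφa z hz) (hφp z hz),
      kahlerForm_of_radial (hφa z hz) (hb z hz).2.1, ofReal_mul]
  refine ⟨U, V, Ψ, ⟨fun z hz => (hb z hz.1).2.2.1, fun z hz => (hb z hz.1).2.2.2,
    ⟨h0, by rw [mem_preimage, hΨ0]; exact h0⟩, ⟨h0, by rw [mem_preimage, hΘ0]; exact h0⟩,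
    ⟨hUo, hVo, hUV, hΨs.mono inter_subset_left, Θ, hVU, hΘs.mono inter_subset_left,
      fun z hz => hΘΨ z hz.1, fun z hz => hΨΘ z hz.1⟩,
    fun z hz => hflat z hz.1, fun z hz v w => ?_⟩⟩
  have hd1 : HasFDerivAt Ψ (fderiv ℝ Ψ z) z :=
    ((hΨs.contDiffAt (Metric.isOpen_ball.mem_nhds hz.1)).differentiableAt (by simp)).hasFDerivAt
  have hd2 : HasFDerivAt Θ (fderiv ℝ Θ (Ψ z)) (Ψ z) :=
    ((hΘs.contDiffAt (Metric.isOpen_ball.mem_nhds hz.2)).differentiableAt (by simp)).hasFDerivAt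
  have hd3 : HasFDerivAt (Θ ∘ Ψ) (ContinuousLinearMap.id ℝ (Cn n)) z := by
    refine (hasFDerivAt_id z).congr_of_eventuallyEq ?_
    filter_upwards [Metric.isOpen_ball.mem_nhds hz.1] with u hu using hΘΨ u hu
  have hid : ∀ u, fderiv ℝ Θ (Ψ z) (fderiv ℝ Ψ z u) = u := fun u =>
    congrArg (fun L : Cn n →L[ℝ] Cn n => L u) ((hd2.comp z hd1).unique hd3)
  rw [← hflat' _ hz.2, hid, hid]

end Potential

theorem theorem4 {n : ℕ} (M : Set (Cn n)) (Φ : Cn n → ℝ) (f : ℝ → ℝ)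
    (Mstar : Set (Cn n)) (Φstar : Cn n → ℝ) (lam : ℝ)
    (hM : IsComplexDomain M) (hΦ : IsKahlerPotential M Φ)
    (hf : IsAssociatedFunction M Φ f) (hdual : IsLocalDual Φ Mstar Φstar)
    (hnp : NowhereProportional M Φ) (hlam : 0 < lam) :
    (∀ (U Ustar : Set (Cn n)) (Ψ : Cn n → Cn n),
      IsSymplecticDuality lam M Φ Mstar Φstar U Ustar Ψ →
        ∃ V ⊆ U, IsOpen V ∧ (0 : Cn n) ∈ V ∧
          (∀ z ∈ V, 0 < lam * deriv f (‖z‖ ^ 2)) ∧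
          AnalyticOnNhd ℝ (fun z : Cn n => Real.sqrt (lam * deriv f (‖z‖ ^ 2))) V ∧
          ∃ g : Cn n → ℝ, IsRadialOn V g ∧
            ∃ A ∈ Matrix.unitaryGroup (Fin n) ℂ, ∀ z ∈ V,
              Ψ z = (Complex.exp (I * (g z : ℂ)) *
                (Real.sqrt (lam * deriv f (‖z‖ ^ 2)) : ℂ)) • Matrix.toEuclideanLin A z) ∧
    ((∃ (U Ustar : Set (Cn n)) (Ψ : Cn n → Cn n),
        IsSymplecticDuality lam M Φ Mstar Φstar U Ustar Ψ) ↔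
      ∀ᶠ x : ℝ in 𝓝 0, lam ^ 2 * deriv f x * deriv f (-(lam * x * deriv f x)) = 1) := by

  have hn := hnp.dim_ne_zero hM
  refine ⟨fun U Ustar Ψ hΨ => ?_, ⟨?_, fun h =>
    exists_isSymplecticDuality hM hΦ hf hdual hn hlam h⟩⟩
  · obtain ⟨ε, -, hεU, H₀⟩ := hΨ.exists_isRadialDuality hM hΦ hf hdual hnp hlam
    obtain ⟨δ, hδ, hδε, hI⟩ := H₀.exists_fderiv_I_smul
    have H := H₀.mono hδ hδε
    obtain ⟨g, hg, T, hT⟩ := H.exists_radial_phase hI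
    obtain ⟨A, hA, hAT⟩ := exists_mem_unitaryGroup_toEuclideanLin_eq T
    have hpos : ∀ z ∈ Metric.ball (0 : Cn n) δ, 0 < lam * deriv f (‖z‖ ^ 2) := fun z hz =>
      mul_pos hlam (H.deriv_pos z hz)
    refine ⟨Metric.ball 0 δ, (Metric.ball_subset_ball hδε).trans hεU, Metric.isOpen_ball,
      H.zero_mem, hpos, fun z hz => analyticAt_sqrt_mul_deriv (H.analyticAt z hz) (hpos z hz),
      g, hg, A, hA, fun z hz => ?_⟩
    rw [hAT, hT z hz]
  · rintro ⟨U, Ustar, Ψ, hΨ⟩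
    obtain ⟨ε, -, -, H₀⟩ := hΨ.exists_isRadialDuality hM hΦ hf hdual hnp hlam
    obtain ⟨δ, hδ, hδε, hI⟩ := H₀.exists_fderiv_I_smul
    exact (H₀.mono hδ hδε).eventually_mul_deriv_eq_one hI
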